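/- Let $C_R$ be the open cube of edge length $R$ about $0$ in $\mathbb{R}^d$, let $\ell$ be Lebesgue measure, and let $M_p$ be the set of point measures on $\mathbb{R}^d$ (Borel measures taking natural-number values on bounded Borel sets), with the $\sigma$-algebra generated by the maps $\lambda\mapsto\lambda(A)$, $A$ Borel (equivalently, the Borel $\sigma$-algebra of the vague topology). For $t\in\mathbb{R}^d$ let $T_t\lambda(A)=\lambda(-t+A)$. Let $\mu$ be a probability measure on $M_p$ which is the law of a one-colour uniformly discrete stationary ergodic point process of positive intensity; that is: - for some $r>0$, $\mu$-almost every $\lambda$ satisfies $\lambda(a+C_r)\le 1$ for all $a\in\mathbb{R}^d$; - $\mu$ is invariant under every $T_t$, and every measurable set invariant under all $T_t$ has $\mu$-measure $0$ or $1$; - the intensity $\int \lambda(C_1)\,d\mu(\lambda)/\ell(C_1)$ is positive. Assume that $\mu$-almost surely the point set $\Lambda=\{x:\lambda(\{x\})\ne 0\}$ has finite local complexity, i.e. for every $R$ there are only finitely many patches $(-x+\Lambda)\cap B_R$, $x\in\Lambda$, where $B_R$ is the open ball of radius $R$ about $0$. Let $\dot\mu$ be the (unnormalised) Palm measure of $\mu$,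 $$\dot\mu(D)=\frac{1}{\ell(B)}\int \sum_{x\in B}\lambda(\{x\})\,\mathbf 1_D(T_{-x}\lambda)\,d\mu(\lambda),$$ which does not depend on the choice of the bounded Borel set $B$ of positive volume, and let $\dot\mu_1(A)=\int\lambda(A)\,d\dot\mu(\lambda)$ be its first moment (almost surely the autocorrelation of $\lambda$). Then $\dot\mu_1$ has a unique Fourier transform $\widehat{\dot\mu_1}$ that is a positive tempered measure, i.e. there is exactly one positive tempered measure with $\widehat{\dot\mu_1}(f)=\dot\mu_1(\hat f)$ for all Schwartz functions $f$, where $\hat f(y)=\int e^{-2\pi i x\cdot y}f(x)\,dx$ and $\dot\mu_1$ is itself tempered; and for all $k,t\in\mathbb{R}^d$, $$\left|e^{2\pi i k\cdot t}-1\right|\,\widehat{\dot\mu_1}(\{k\})^{1/2}\le 2\bigl(\dot\mu_1(\{0\})-\dot\mu_1(\{t\})\bigr).$$ -/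

import Mathlib

open MeasureTheory Set
open scoped ENNReal SchwartzMap FourierTransform

/-- The space `ℝ^d` with its Euclidean distance. -/
abbrev Space (d : ℕ) : Type := EuclideanSpace ℝ (Fin d)

/-- The open cube `C_R` of edge length `R` about `0`. -/
def cube (d : ℕ) (R : ℝ) : Set (Space d) := {x | ∀ i, |x i| < R / 2}

/-- The space `M_p` of (one-colour) point measures on `ℝ^d`: the positive Borel measures whose
value on every bounded (equivalently, relatively compact) Borel set is a natural number. -/
structure PointMeasure (d : ℕ) where
  /-- the underlying Borel measure -/
  toMeasure : Measure (Space d)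
  /-- bounded Borel sets have finite integer mass -/
  exists_nat' : ∀ A : Set (Space d), MeasurableSet A → Bornology.IsBounded A →
    ∃ n : ℕ, toMeasure A = n

namespace PointMeasure

variable {d : ℕ}

/-- The σ-algebra on `M_p` generated by the evaluations `ν ↦ ν A`, `A` Borel. (On `M_p` this is
the Borel σ-algebra of the vague topology.) -/
instance : MeasurableSpace (PointMeasure d) :=
  MeasurableSpace.comap PointMeasure.toMeasure inferInstance

/-- The point set `Λ = {x | ν {x} ≠ 0}` carried by a point measure `ν`. -/
def points (ν : PointMeasure d) : Set (Space d) := {x | ν.toMeasure {x} ≠ 0}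

/-- The translate `T_t ν`, with `(T_t ν) A = ν (-t + A)`. -/
noncomputable def translate (t : Space d) (ν : PointMeasure d) : PointMeasure d where
  toMeasure := ν.toMeasure.map (fun x => t + x)
  exists_nat' A hA hb := by
    rw [Measure.map_apply (measurable_const_add t) hA]
    refine ν.exists_nat' _ (measurable_const_add t hA) ?_
    have h : (fun x => t + x) ⁻¹' A = (fun x => -t + x) '' A := by
      ext x
      constructor
      · intro hx
        exact ⟨t + x, hx, by simp⟩
      · rintro ⟨y, hy, rfl⟩
        simpa using hy
    rw [h]
    exact (isometry_add_left (-t)).lipschitz.isBounded_image hb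

end PointMeasure

/-- `ν` is `r`-uniformly discrete: every translate `a + C_r` contains at most one point. -/
def IsUniformlyDiscrete {d : ℕ} (r : ℝ) (ν : PointMeasure d) : Prop :=
  ∀ a : Space d, ν.toMeasure ((fun x => a + x) '' cube d r) ≤ 1

/-- The law `μ` of a point process is stationary: it is invariant under all translations. -/
def IsStationaryLaw {d : ℕ} (μ : Measure (PointMeasure d)) : Prop :=
  ∀ t : Space d, MeasurePreserving (PointMeasure.translate t) μ μ

/-- The law `μ` of a point process is ergodic: every measurable set that is invariant under all
translations is null or conull. -/
def IsErgodicLaw {d : ℕ} (μ : Measure (PointMeasure d)) : Prop :=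
  ∀ D : Set (PointMeasure d), MeasurableSet D →
    (∀ t : Space d, PointMeasure.translate t ⁻¹' D = D) → μ D = 0 ∨ μ Dᶜ = 0

/-- The intensity of a stationary point process: the expected number of points per unit
volume. (By stationarity the cube `C_1` may be replaced by any Borel set of positive finite
volume.) -/
noncomputable def intensity {d : ℕ} (μ : Measure (PointMeasure d)) : ℝ≥0∞ :=
  (∫⁻ ν, ν.toMeasure (cube d 1) ∂μ) / volume (cube d 1)

/-- The law `μ` on `M_p` is that of a one-colour uniformly discrete stationary ergodic point
process of positive intensity on `ℝ^d`. -/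
structure IsUniformlyDiscreteErgodicProcess {d : ℕ} (μ : Measure (PointMeasure d)) : Prop where
  isProbabilityMeasure : IsProbabilityMeasure μ
  uniformlyDiscrete : ∃ r : ℝ, 0 < r ∧ ∀ᵐ ν ∂μ, IsUniformlyDiscrete r ν
  stationary : IsStationaryLaw μ
  intensity_pos : 0 < intensity μ
  ergodic : IsErgodicLaw μ

/-- A point set has finite local complexity: for every radius `R` it has only finitely many
patches `(-x + Λ) ∩ B_R`, `x ∈ Λ`. -/
def HasFiniteLocalComplexity {d : ℕ} (Λ : Set (Space d)) : Prop :=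
  ∀ R : ℝ, {P : Set (Space d) | ∃ x ∈ Λ, P = ((fun y => -x + y) '' Λ) ∩ Metric.ball 0 R}.Finite

/-- The (unnormalised) Palm measure
`D ↦ (1 / ℓ(B)) ∫ ∑_{x ∈ B} ν {x} 1_D (T_{-x} ν) dμ(ν)`, with the choice `B = C_1`.
(By stationarity any Borel `B` of positive finite volume gives the same measure.) -/
noncomputable def palmMeasure {d : ℕ} (μ : Measure (PointMeasure d)) : Measure (PointMeasure d) :=
  (volume (cube d 1))⁻¹ • μ.bind (fun ν =>
    (ν.toMeasure.restrict (cube d 1)).map (fun x => PointMeasure.translate (-x) ν))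

/-- The first moment `A ↦ ∫ ν A dω(ν)` of a measure `ω` on `M_p`. -/
noncomputable def firstMoment {d : ℕ} (ω : Measure (PointMeasure d)) : Measure (Space d) :=
  ω.bind PointMeasure.toMeasure

/-- The positive measure `σ` is the Fourier transform of the positive measure `ω`:
both are tempered, and `σ(f) = ω(f̂)` for every rapidly decreasing `f`, where
`f̂(y) = ∫ e^{-2πi x·y} f(x) dx`. -/
structure IsFourierTransform {d : ℕ} (ω σ : Measure (Space d)) : Prop where
  temperate_left : ω.HasTemperateGrowth
  temperate_right : σ.HasTemperateGrowth
  integral_eq : ∀ f : 𝓢(Space d, ℂ), ∫ x, f x ∂σ = ∫ x, (𝓕 f) x ∂ω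

/-!
Let `γ` be the autocorrelation. Pushing the second moment of `μ` forward under
`(x, y) ↦ (x, y - x)` gives `ℓ ⊗ γ` by stationarity, so the covariance of two linear statistics
`∫ φ dν`, `∫ ψ dν` is an integral against `γ`. Taking `φ = ψ` a modulated Gaussian shows that every
Gaussian-damped version of `γ` has a nonnegative, bounded Fourier transform; these transforms are
uniformly translation bounded, and a limit as the damping disappears is the required `σ`.

For general Schwartz functions the same covariance formula, with Plancherel, says that
`f ↦ ∫ 𝓕 f dν` extends to an isometry `L²(σ) → L²(μ)`. Let `c` be the image of `1_{k}`. It is an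
eigenfunction of all translations with `‖c‖₂ = √(σ {k})`, and ergodicity makes `|c|` constant, so
that `‖c - c ∘ T_t‖₁ = |e^{2πi k·t} - 1| √(σ {k})`. On the other hand `c` is a limit of statistics
`∫ 𝓕 g dν` with `g` a Gaussian peaking at `k`. Points common to `ν` and `T_t ν` cancel in
`∫ 𝓕 g dν - ∫ 𝓕 g d(T_t ν)`, and the remaining ones have density `2 (γ {0} - γ {t})`; since
`‖𝓕 g‖₁ = 1`, this bounds the `L¹(μ)` norm of the difference uniformly in `g`.
-/

section Kernel

open ProbabilityTheory

variable {α β : Type*} [MeasurableSpace α] [MeasurableSpace β] {κ : Kernel α β}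

theorem isSFiniteKernel_of_forall_isFiniteMeasure (h : ∀ a, IsFiniteMeasure (κ a)) :
    IsSFiniteKernel κ := by
  classical
  let mass (a : α) : ℕ := ⌊(κ a univ).toNNReal⌋₊
  have hmass (n : ℕ) : MeasurableSet {a | mass a = n} :=
    (Nat.measurable_floor.comp (κ.measurable_coe .univ).ennreal_toNNReal)
      (measurableSet_singleton n)
  let K (n : ℕ) : Kernel α β := Kernel.piecewise (hmass n) κ 0
  have hK (n : ℕ) : IsFiniteKernel (K n) := by
    refine ⟨⟨n + 1, by finiteness, fun a => ?_⟩⟩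
    by_cases ha : mass a = n
    · simp only [K, Kernel.piecewise_apply, mem_ofPred_eq, ha, if_true]
      rw [← ENNReal.coe_toNNReal (measure_ne_top (κ a) univ)]
      have hle : (κ a univ).toNNReal ≤ mass a + 1 := (Nat.lt_floor_add_one _).le
      rw [ha] at hle
      exact_mod_cast hle
    · simp [K, Kernel.piecewise_apply, ha]
  have hsum : κ = Kernel.sum K := by
    ext a s hs
    rw [Kernel.sum_apply' _ _ hs, tsum_eq_single (mass a)]
    · simp [K, Kernel.piecewise_apply]
    · intro n hn
      simp [K, Kernel.piecewise_apply, hn.symm]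
  rw [hsum]
  infer_instance

theorem isSFiniteKernel_of_forall_measure_lt_top {S : ℕ → Set β} (hS : ∀ m, MeasurableSet (S m))
    (hU : ⋃ m, S m = univ) (hfin : ∀ a m, κ a (S m) < ∞) : IsSFiniteKernel κ := by
  have hD := MeasurableSet.disjointed hS
  have hsum : κ = Kernel.sum fun m => κ.restrict (hD m) := by
    ext1 a
    simp_rw [Kernel.sum_apply, Kernel.restrict_apply]
    rw [← Measure.restrict_iUnion (disjoint_disjointed S) hD, iUnion_disjointed, hU,
      Measure.restrict_univ]
  have (m : ℕ) : IsSFiniteKernel (κ.restrict (hD m)) :=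
    isSFiniteKernel_of_forall_isFiniteMeasure fun a =>
      ⟨by simpa [Kernel.restrict_apply] using
        (measure_mono (disjointed_subset S m)).trans_lt (hfin a m)⟩
  rw [hsum]
  infer_instance

end Kernel

section InvariantMeasure

variable {G : Type*} [AddCommGroup G] [MeasurableSpace G] [MeasurableAdd₂ G] [MeasurableNeg G]

/- Integrate `1_C (x - s) H (x, y)` over `(x, y)` and `s` in both orders; on one side translate
`(x, y)` back by `s` first. -/
theorem measure_mul_lintegral_eq_of_diagonal_invariant (m : Measure G) [SFinite m]
    [m.IsAddLeftInvariant] [m.IsNegInvariant] {M : Measure (G × G)} [SFinite M]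
    (hM : ∀ s, MeasurePreserving (fun p : G × G => (s + p.1, s + p.2)) M M) {C : Set G}
    (hC : MeasurableSet C) {H : G × G → ℝ≥0∞} (hH : Measurable H) :
    m C * ∫⁻ p, H p ∂M = ∫⁻ p in Prod.fst ⁻¹' C, ∫⁻ x, H (x, x + (-p.1 + p.2)) ∂m ∂M := by
  have : Measurable (C.indicator (1 : G → ℝ≥0∞)) := measurable_one.indicator hC
  have hmass (x : G) : ∫⁻ s, C.indicator 1 (-s + x) ∂m = m C := by
    simp_rw [neg_add_eq_sub]
    rw [lintegral_sub_left_eq_self (C.indicator 1) x, lintegral_indicator_one hC]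
  have hshift (p : G × G) :
      ∫⁻ s, H (s + p.1, s + p.2) ∂m = ∫⁻ x, H (x, x + (-p.1 + p.2)) ∂m := by
    rw [← lintegral_add_right_eq_self (fun x => H (x, x + (-p.1 + p.2))) p.1]
    simp only [add_assoc, add_neg_cancel_left]
  calc m C * ∫⁻ p, H p ∂M
      = ∫⁻ p, ∫⁻ s, C.indicator 1 (-s + p.1) * H p ∂m ∂M := by
        rw [← lintegral_const_mul _ hH]
        refine lintegral_congr fun p => ?_
        rw [lintegral_mul_const _ (by fun_prop), hmass]
    _ = ∫⁻ s, ∫⁻ p, C.indicator 1 (-s + p.1) * H p ∂M ∂m :=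
        lintegral_lintegral_swap (by fun_prop)
    _ = ∫⁻ s, ∫⁻ p, C.indicator 1 p.1 * H (s + p.1, s + p.2) ∂M ∂m := by
        refine lintegral_congr fun s => ?_
        rw [← (hM s).lintegral_comp (by fun_prop)]
        simp only [neg_add_cancel_left]
    _ = ∫⁻ p, ∫⁻ s, C.indicator 1 p.1 * H (s + p.1, s + p.2) ∂m ∂M :=
        lintegral_lintegral_swap (by fun_prop)
    _ = ∫⁻ p in Prod.fst ⁻¹' C, ∫⁻ x, H (x, x + (-p.1 + p.2)) ∂m ∂M := by
        rw [← lintegral_indicator (measurable_fst hC)]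
        refine lintegral_congr fun p => ?_
        rw [lintegral_const_mul _ (by fun_prop)]
        by_cases hp : p.1 ∈ C <;> simp [hp, hshift]

end InvariantMeasure

namespace PointMeasure

open ProbabilityTheory

variable {d : ℕ}

theorem measurable_toMeasure : Measurable (toMeasure : PointMeasure d → Measure (Space d)) :=
  comap_measurable _

/-- The tautological kernel, sending a point measure to itself. -/
noncomputable def kernel (d : ℕ) : Kernel (PointMeasure d) (Space d) where
  toFun := toMeasure
  measurable' := measurable_toMeasure

theorem kernel_apply (ν : PointMeasure d) : kernel d ν = ν.toMeasure := rfl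

instance (ν : PointMeasure d) : IsLocallyFiniteMeasure ν.toMeasure where
  finiteAtNhds x := by
    obtain ⟨n, hn⟩ := ν.exists_nat' (Metric.ball x 1) Metric.isOpen_ball.measurableSet
      Metric.isBounded_ball
    exact ⟨_, Metric.ball_mem_nhds x one_pos, hn ▸ ENNReal.natCast_lt_top n⟩

instance : IsSFiniteKernel (kernel d) :=
  isSFiniteKernel_of_forall_measure_lt_top (S := fun m : ℕ => Metric.ball 0 m)
    (fun _ => Metric.isOpen_ball.measurableSet) (Metric.iUnion_ball_nat 0)
    fun ν _ => measure_ball_lt_top (μ := ν.toMeasure)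

theorem measurable_lintegral {f : PointMeasure d → Space d → ℝ≥0∞}
    (hf : Measurable (Function.uncurry f)) : Measurable fun ν => ∫⁻ x, f ν x ∂ν.toMeasure :=
  hf.lintegral_kernel_prod_right (κ := kernel d)

theorem lintegral_translate (t : Space d) (ν : PointMeasure d) (f : Space d → ℝ≥0∞) :
    ∫⁻ x, f x ∂(translate t ν).toMeasure = ∫⁻ x, f (t + x) ∂ν.toMeasure :=
  lintegral_map_equiv f (MeasurableEquiv.addLeft t)

theorem integral_translate (t : Space d) (ν : PointMeasure d) (f : Space d → ℂ) :
    ∫ x, f x ∂(translate t ν).toMeasure = ∫ x, f (t + x) ∂ν.toMeasure :=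
  integral_map_equiv (MeasurableEquiv.addLeft t) f

theorem translate_translate (s t : Space d) (ν : PointMeasure d) :
    translate s (translate t ν) = translate (s + t) ν := by
  cases ν
  simp only [translate, mk.injEq]
  rw [Measure.map_map (measurable_const_add s) (measurable_const_add t)]
  simp only [Function.comp_def, add_assoc]

theorem measurable_translate :
    Measurable fun p : Space d × PointMeasure d => translate p.1 p.2 := by
  refine measurable_comap_iff.2 (Measure.measurable_of_measurable_coe _ fun A hA => ?_)
  let κ : Kernel (Space d × PointMeasure d) (Space d) := (kernel d).comap Prod.snd measurable_snd
  have hmap (p : Space d × PointMeasure d) : (translate p.1 p.2).toMeasure A =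
      κ p (Prod.mk p ⁻¹' ((fun q : (Space d × PointMeasure d) × Space d => q.1.1 + q.2) ⁻¹' A)) :=
    Measure.map_apply (measurable_const_add _) hA
  simp only [Function.comp_apply, hmap]
  exact Kernel.measurable_kernel_prodMk_left ((measurable_fst.fst.add measurable_snd) hA)

/-- The second moment `A ↦ ∫ (ν ⊗ ν) A dμ(ν)` of a measure `μ` on `M_p`. -/
noncomputable def secondMoment (μ : Measure (PointMeasure d)) : Measure (Space d × Space d) :=
  (kernel d ×ₖ kernel d) ∘ₘ μ

instance (μ : Measure (PointMeasure d)) [SFinite μ] : SFinite (secondMoment μ) :=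
  inferInstanceAs (SFinite ((kernel d ×ₖ kernel d) ∘ₘ μ))

theorem lintegral_secondMoment (μ : Measure (PointMeasure d)) {F : Space d × Space d → ℝ≥0∞}
    (hF : Measurable F) : ∫⁻ p, F p ∂(secondMoment μ) =
      ∫⁻ ν, ∫⁻ x, ∫⁻ y, F (x, y) ∂ν.toMeasure ∂ν.toMeasure ∂μ := by
  rw [secondMoment, Measure.lintegral_bind (Kernel.aemeasurable _) hF.aemeasurable]
  refine lintegral_congr fun ν => ?_
  rw [Kernel.prod_apply, lintegral_prod _ hF.aemeasurable, kernel_apply]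

/-- The first moment of the Palm measure of `μ`, which is almost surely the autocorrelation of
the point measure in the ergodic case. -/
noncomputable abbrev autocorrelation (μ : Measure (PointMeasure d)) : Measure (Space d) :=
  firstMoment (palmMeasure μ)

end PointMeasure

section Palm

open PointMeasure ProbabilityTheory

variable {d : ℕ}

theorem isOpen_cube (d : ℕ) (R : ℝ) : IsOpen (cube d R) := by
  have : cube d R = ⋂ i, {x : Space d | |x i| < R / 2} := by ext; simp [cube]
  rw [this]
  exact isOpen_iInter_of_finite fun i => isOpen_lt (by fun_prop) continuous_const

theorem ball_subset_cube (d : ℕ) (R : ℝ) : Metric.ball 0 (R / 2) ⊆ cube d R := by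
  intro x hx i
  rw [mem_ball_zero_iff] at hx
  exact (PiLp.norm_apply_le x i).trans_lt hx

theorem isBounded_cube (d : ℕ) (R : ℝ) : Bornology.IsBounded (cube d R) :=
  ((PiLp.antilipschitzWith_ofLp 2 fun _ : Fin d => ℝ).isBounded_preimage
    (Bornology.IsBounded.pi fun _ => Metric.isBounded_Ioo (-(R / 2)) (R / 2))).subset
    fun _ hx i _ => abs_lt.1 (hx i)

theorem volume_cube_ne_zero (d : ℕ) {R : ℝ} (hR : 0 < R) : volume (cube d R) ≠ 0 :=
  ((isOpen_cube d R).measure_pos volume ⟨0, fun i => by simpa using hR⟩).ne'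

theorem volume_cube_ne_top (d : ℕ) (R : ℝ) : volume (cube d R) ≠ ∞ :=
  (isBounded_cube d R).measure_lt_top.ne

theorem measurable_map_translate_neg (d : ℕ) {C : Set (Space d)} (hC : MeasurableSet C) :
    Measurable fun ν : PointMeasure d =>
      (ν.toMeasure.restrict C).map fun x => translate (-x) ν := by
  have hm : Measurable fun p : PointMeasure d × Space d => translate (-p.2) p.1 :=
    measurable_translate.comp (measurable_snd.neg.prodMk measurable_fst)
  convert ((Kernel.id ×ₖ (kernel d).restrict hC).map fun p => translate (-p.2) p.1).measurable
    using 2 with ν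
  rw [Kernel.map_apply _ hm, Kernel.prod_apply, Kernel.id_apply, Measure.dirac_prod,
    Measure.map_map hm measurable_prodMk_left, Kernel.restrict_apply, kernel_apply]
  rfl

theorem lintegral_palmMeasure (μ : Measure (PointMeasure d)) {F : PointMeasure d → ℝ≥0∞}
    (hF : Measurable F) :
    ∫⁻ ν, F ν ∂(palmMeasure μ) = (volume (cube d 1))⁻¹ *
      ∫⁻ ν, ∫⁻ x in cube d 1, F (translate (-x) ν) ∂ν.toMeasure ∂μ := by
  have hC := (isOpen_cube d 1).measurableSet
  rw [palmMeasure, lintegral_smul_measure, smul_eq_mul,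
    Measure.lintegral_bind (measurable_map_translate_neg d hC).aemeasurable hF.aemeasurable]
  congr 1
  refine lintegral_congr fun ν => lintegral_map hF ?_
  exact measurable_translate.comp (measurable_neg.prodMk measurable_const)

theorem lintegral_autocorrelation (μ : Measure (PointMeasure d)) {F : Space d → ℝ≥0∞}
    (hF : Measurable F) :
    ∫⁻ z, F z ∂(autocorrelation μ) = (volume (cube d 1))⁻¹ *
      ∫⁻ ν, ∫⁻ x in cube d 1, ∫⁻ y, F (-x + y) ∂ν.toMeasure ∂ν.toMeasure ∂μ := by
  rw [autocorrelation, firstMoment,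
    Measure.lintegral_bind measurable_toMeasure.aemeasurable hF.aemeasurable,
    lintegral_palmMeasure μ (measurable_lintegral (f := fun _ => F) (hF.comp measurable_snd))]
  simp_rw [lintegral_translate]

theorem autocorrelation_eq_map_secondMoment (μ : Measure (PointMeasure d)) :
    autocorrelation μ = (volume (cube d 1))⁻¹ •
      ((secondMoment μ).restrict (Prod.fst ⁻¹' cube d 1)).map fun p => -p.1 + p.2 := by
  have hC := (isOpen_cube d 1).measurableSet
  refine Measure.ext_of_lintegral _ fun F hF => ?_
  rw [lintegral_autocorrelation μ hF, lintegral_smul_measure, smul_eq_mul,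
    lintegral_map hF (by fun_prop), ← lintegral_indicator (measurable_fst hC),
    lintegral_secondMoment μ ((by fun_prop : Measurable _).indicator (measurable_fst hC))]
  congr 1
  refine lintegral_congr fun ν => ?_
  rw [← lintegral_indicator hC]
  refine lintegral_congr fun x => ?_
  by_cases hx : x ∈ cube d 1 <;> simp [hx]

theorem IsStationaryLaw.measurePreserving_secondMoment {μ : Measure (PointMeasure d)}
    (hμ : IsStationaryLaw μ) (t : Space d) :
    MeasurePreserving (fun p : Space d × Space d => (t + p.1, t + p.2)) (secondMoment μ)
      (secondMoment μ) := by
  refine ⟨by fun_prop, Measure.ext_of_lintegral _ fun F hF => ?_⟩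
  have hm : Measurable fun ν : PointMeasure d =>
      ∫⁻ x, ∫⁻ y, F (x, y) ∂ν.toMeasure ∂ν.toMeasure := by
    convert hF.lintegral_kernel (κ := kernel d ×ₖ kernel d) using 2 with ν
    rw [Kernel.prod_apply, lintegral_prod _ hF.aemeasurable, kernel_apply]
  rw [lintegral_map hF (by fun_prop), lintegral_secondMoment μ (by fun_prop),
    lintegral_secondMoment μ hF, ← (hμ t).lintegral_comp hm]
  simp_rw [lintegral_translate]

theorem IsStationaryLaw.lintegral_secondMoment {μ : Measure (PointMeasure d)} [SFinite μ]
    (hμ : IsStationaryLaw μ) {H : Space d × Space d → ℝ≥0∞} (hH : Measurable H) :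
    ∫⁻ p, H p ∂(secondMoment μ) = ∫⁻ z, ∫⁻ x, H (x, x + z) ∂volume ∂(autocorrelation μ) := by
  have hF : Measurable fun z => ∫⁻ x, H (x, x + z) :=
    Measurable.lintegral_prod_right' (f := fun p : Space d × Space d => H (p.2, p.2 + p.1))
      (by fun_prop)
  rw [autocorrelation_eq_map_secondMoment, lintegral_smul_measure, lintegral_map hF (by fun_prop),
    ← measure_mul_lintegral_eq_of_diagonal_invariant volume hμ.measurePreserving_secondMoment
      (isOpen_cube d 1).measurableSet hH, smul_eq_mul, ← mul_assoc,
    ENNReal.inv_mul_cancel (volume_cube_ne_zero d one_pos) (volume_cube_ne_top d 1), one_mul]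

end Palm

section TranslationBounded

open Metric Module

open scoped NNReal

/-- `ρ` is translation bounded at scale `δ`: all balls of radius `δ` have mass at most `C`. The
constants are explicit because uniformity over families of measures matters. -/
def IsTranslationBounded {X : Type*} [PseudoMetricSpace X] [MeasurableSpace X] (ρ : Measure X)
    (δ : ℝ) (C : ℝ≥0) : Prop :=
  ∀ a, ρ (ball a δ) ≤ C

theorem IsTranslationBounded.isLocallyFiniteMeasure {X : Type*} [PseudoMetricSpace X]
    [MeasurableSpace X] {ρ : Measure X} {δ : ℝ} {C : ℝ≥0} (h : IsTranslationBounded ρ δ C)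
    (hδ : 0 < δ) : IsLocallyFiniteMeasure ρ :=
  ⟨fun x => ⟨_, ball_mem_nhds x hδ, (h x).trans_lt ENNReal.coe_lt_top⟩⟩

theorem exists_forall_measure_le_of_isTranslationBounded {X : Type*} [PseudoMetricSpace X]
    [ProperSpace X] [MeasurableSpace X] {A : Set X} (hA : Bornology.IsBounded A) {δ : ℝ}
    (hδ : 0 < δ) : ∃ N : ℕ, ∀ (ρ : Measure X) (C : ℝ≥0), IsTranslationBounded ρ δ C →
      ρ A ≤ N * C := by
  obtain ⟨t, ht, hAt⟩ := totallyBounded_iff.1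
    (hA.isCompact_closure.totallyBounded.subset subset_closure) δ hδ
  lift t to Finset X using ht
  refine ⟨t.card, fun ρ C hρ => ?_⟩
  calc ρ A ≤ ∑ a ∈ t, ρ (ball a δ) := (measure_mono hAt).trans (measure_biUnion_finset_le t _)
    _ ≤ ∑ _a ∈ t, (C : ℝ≥0∞) := Finset.sum_le_sum fun a _ => hρ a
    _ = t.card * C := by simp

/-- The weight `(1 + ‖x‖)^(-m)`. -/
noncomputable def polyWeight {V : Type*} [Norm V] (m : ℕ) (x : V) : ℝ := (1 + ‖x‖) ^ (-(m : ℝ))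

section NormedSpace

variable {V : Type*} [NormedAddCommGroup V]

theorem polyWeight_eq_inv_pow (m : ℕ) (x : V) : polyWeight m x = ((1 + ‖x‖) ^ m)⁻¹ := by
  rw [polyWeight, Real.rpow_neg (by positivity), Real.rpow_natCast]

theorem polyWeight_pos (m : ℕ) (x : V) : 0 < polyWeight m x := by
  rw [polyWeight_eq_inv_pow]
  positivity

theorem continuous_polyWeight (m : ℕ) : Continuous (polyWeight m : V → ℝ) :=
  (by fun_prop : Continuous fun x : V => 1 + ‖x‖).rpow_const fun x => Or.inl (by positivity)

theorem polyWeight_le_of_dist_le {m : ℕ} {x y : V} {δ : ℝ} (h : dist x y ≤ δ) :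
    polyWeight m y ≤ (1 + δ) ^ m * polyWeight m x := by
  have hδ : 0 ≤ δ := dist_nonneg.trans h
  have hle : 1 + ‖x‖ ≤ (1 + δ) * (1 + ‖y‖) := by
    have : ‖x‖ ≤ ‖y‖ + ‖x - y‖ := norm_le_norm_add_norm_sub' x y
    rw [← dist_eq_norm] at this
    nlinarith [norm_nonneg y]
  rw [polyWeight_eq_inv_pow, polyWeight_eq_inv_pow, ← div_eq_mul_inv,
    le_div_iff₀ (by positivity), inv_mul_le_iff₀ (by positivity), mul_comm, ← mul_pow]
  gcongr

theorem exists_norm_le_mul_polyWeight [NormedSpace ℝ V] {F : Type*} [NormedAddCommGroup F]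
    [NormedSpace ℝ F] (f : 𝓢(V, F)) (m : ℕ) :
    ∃ C : ℝ, 0 ≤ C ∧ ∀ x, ‖f x‖ ≤ C * polyWeight m x := by
  refine ⟨2 ^ m * ((Finset.Iic (m, 0)).sup fun k => SchwartzMap.seminorm ℝ k.1 k.2) f,
    by positivity, fun x => ?_⟩
  have := SchwartzMap.one_add_le_sup_seminorm_apply (𝕜 := ℝ) (m := (m, 0)) le_rfl le_rfl f x
  rw [polyWeight_eq_inv_pow, ← div_eq_mul_inv, le_div_iff₀ (by positivity), mul_comm]
  simpa using this

end NormedSpace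

variable {V : Type*} [NormedAddCommGroup V] [MeasurableSpace V]

theorem lintegral_polyWeight_ne_top_iff {m : ℕ} {ρ : Measure V} [OpensMeasurableSpace V] :
    ∫⁻ x, ENNReal.ofReal (polyWeight m x) ∂ρ ≠ ∞ ↔ Integrable (polyWeight m) ρ := by
  rw [Integrable, and_iff_right (continuous_polyWeight m).aestronglyMeasurable,
    hasFiniteIntegral_iff_ofReal (ae_of_all _ fun x => (polyWeight_pos m x).le), lt_top_iff_ne_top]

variable [NormedSpace ℝ V] [FiniteDimensional ℝ V] [BorelSpace V]

theorem IsTranslationBounded.measure_ball_mul_lintegral_le {ρ m : Measure V} [m.IsAddHaarMeasure]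
    {δ : ℝ} {C : ℝ≥0} (hρ : IsTranslationBounded ρ δ C) (hδ : 0 < δ) {F F' : V → ℝ≥0∞}
    (hF : Measurable F) (hF' : Measurable F') (h : ∀ x y, dist x y ≤ δ → F y ≤ F' x) :
    m (ball 0 δ) * ∫⁻ y, F y ∂ρ ≤ C * ∫⁻ x, F' x ∂m := by
  have := hρ.isLocallyFiniteMeasure hδ
  let near : Set (V × V) := {p | dist p.1 p.2 < δ}
  have hnear : MeasurableSet near := (isOpen_lt continuous_dist continuous_const).measurableSet
  calc m (ball 0 δ) * ∫⁻ y, F y ∂ρ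
      = ∫⁻ y, ∫⁻ _ in ball y δ, F y ∂m ∂ρ := by
        rw [← lintegral_const_mul _ hF]
        simp [mul_comm, Measure.addHaar_ball_center m]
    _ ≤ ∫⁻ y, ∫⁻ x, near.indicator (fun p => F' p.1) (x, y) ∂m ∂ρ := by
        refine lintegral_mono fun y => ?_
        rw [← lintegral_indicator isOpen_ball.measurableSet]
        refine lintegral_mono fun x => ?_
        by_cases hx : dist x y < δ <;> simp [near, hx, h x y, le_of_lt]
    _ = ∫⁻ x, ∫⁻ y, near.indicator (fun p => F' p.1) (x, y) ∂ρ ∂m :=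
        lintegral_lintegral_swap
          (((hF'.comp measurable_fst).indicator hnear).comp measurable_swap).aemeasurable
    _ = ∫⁻ x, ρ (ball x δ) * F' x ∂m := by
        refine lintegral_congr fun x => ?_
        have hx : (fun y => near.indicator (fun p => F' p.1) (x, y)) =
            (ball x δ).indicator fun _ => F' x := by
          ext y
          by_cases hy : dist y x < δ <;> simp [near, hy, dist_comm x y]
        rw [hx, lintegral_indicator isOpen_ball.measurableSet, setLIntegral_const, mul_comm]
    _ ≤ C * ∫⁻ x, F' x ∂m := by
        rw [← lintegral_const_mul _ hF']
        exact lintegral_mono fun x => by gcongr; exact hρ x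

theorem exists_forall_lintegral_polyWeight_le {δ : ℝ} (hδ : 0 < δ) (C : ℝ≥0) :
    ∃ K : ℝ≥0, ∀ ρ : Measure V, IsTranslationBounded ρ δ C →
      ∫⁻ x, ENNReal.ofReal (polyWeight (finrank ℝ V + 1) x) ∂ρ ≤ K := by
  have hmeas (k : ℝ) : Measurable fun x : V =>
      ENNReal.ofReal (k * polyWeight (finrank ℝ V + 1) x) :=
    ((continuous_polyWeight _).measurable.const_mul k).ennreal_ofReal
  let m : Measure V := Measure.addHaar
  have hball : m (ball 0 δ) ≠ 0 := (measure_ball_pos m 0 hδ).ne'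
  have hw : Integrable (polyWeight (finrank ℝ V + 1)) m := integrable_one_add_norm (by simp)
  let I : ℝ≥0∞ := ∫⁻ x, ENNReal.ofReal ((1 + δ) ^ (finrank ℝ V + 1) *
    polyWeight (finrank ℝ V + 1) x) ∂m
  have hI : I ≠ ∞ := (hw.const_mul _).lintegral_lt_top.ne
  refine ⟨(C * I / m (ball 0 δ)).toNNReal, fun ρ hρ => ?_⟩
  rw [ENNReal.coe_toNNReal (by finiteness), ENNReal.le_div_iff_mul_le (.inl hball)
    (.inl measure_ball_lt_top.ne), mul_comm]
  exact hρ.measure_ball_mul_lintegral_le hδ (by simpa using hmeas 1) (hmeas _) fun x y hxy =>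
    ENNReal.ofReal_le_ofReal (polyWeight_le_of_dist_le hxy)

theorem IsTranslationBounded.hasTemperateGrowth {ρ : Measure V} {δ : ℝ} {C : ℝ≥0}
    (hρ : IsTranslationBounded ρ δ C) (hδ : 0 < δ) : ρ.HasTemperateGrowth := by
  obtain ⟨K, hK⟩ := exists_forall_lintegral_polyWeight_le (V := V) hδ C
  exact ⟨_, lintegral_polyWeight_ne_top_iff.1 (ne_top_of_le_ne_top ENNReal.coe_ne_top (hK ρ hρ))⟩

end TranslationBounded

section UniformlyDiscrete

open PointMeasure

variable {d : ℕ}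

theorem IsUniformlyDiscrete.isTranslationBounded {r : ℝ} {ν : PointMeasure d}
    (h : IsUniformlyDiscrete r ν) : IsTranslationBounded ν.toMeasure (r / 2) 1 := fun a => by
  refine (measure_mono fun x hx => ?_).trans (h a)
  refine ⟨-a + x, ball_subset_cube d r ?_, by simp⟩
  rwa [neg_add_eq_sub, mem_ball_zero_iff, ← mem_ball_iff_norm]

theorem exists_isTranslationBounded_autocorrelation {μ : Measure (PointMeasure d)}
    [IsFiniteMeasure μ] {r : ℝ} (hr : 0 < r) (hμ : ∀ᵐ ν ∂μ, IsUniformlyDiscrete r ν) :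
    ∃ C, IsTranslationBounded (autocorrelation μ) (r / 2) C := by
  obtain ⟨N, hN⟩ := exists_forall_measure_le_of_isTranslationBounded (isBounded_cube d 1)
    (half_pos hr)
  have hvol := volume_cube_ne_zero d one_pos
  refine ⟨((volume (cube d 1))⁻¹ * (N * μ univ)).toNNReal, fun a => ?_⟩
  have hball := (Metric.isOpen_ball (x := a) (ε := r / 2)).measurableSet
  rw [ENNReal.coe_toNNReal (by finiteness), ← lintegral_indicator_one hball,
    lintegral_autocorrelation μ (measurable_one.indicator hball), ← lintegral_const]
  gcongr (volume (cube d 1))⁻¹ * ?_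
  refine lintegral_mono_ae (hμ.mono fun ν hν => ?_)
  calc ∫⁻ x in cube d 1, ∫⁻ y, (Metric.ball a (r / 2)).indicator 1 (-x + y) ∂ν.toMeasure
        ∂ν.toMeasure
      ≤ ∫⁻ _ in cube d 1, 1 ∂ν.toMeasure := by
        refine lintegral_mono fun x => ?_
        have hx : (fun y => (Metric.ball a (r / 2)).indicator (1 : Space d → ℝ≥0∞) (-x + y)) =
            (Metric.ball (x + a) (r / 2)).indicator 1 := by
          classical
          ext y
          simp only [indicator_apply, mem_ball_iff_norm, neg_add_eq_sub, sub_sub, Pi.one_apply]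
        rw [hx, lintegral_indicator_one Metric.isOpen_ball.measurableSet]
        exact hν.isTranslationBounded (x + a)
    _ ≤ N := by simpa using hN _ _ hν.isTranslationBounded

end UniformlyDiscrete

section SchwartzFunctions

open Module

variable {V : Type*} [NormedAddCommGroup V] [InnerProductSpace ℝ V]

theorem exists_forall_one_add_pow_mul_exp_le {a : ℝ} (ha : 0 < a) (m : ℕ) :
    ∃ C : ℝ, ∀ r : ℝ, 0 ≤ r → (1 + r) ^ m * Real.exp (-a * r ^ 2) ≤ C := by
  refine ⟨m.factorial * Real.exp (1 + 1 / (4 * a)), fun r hr => ?_⟩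
  have hpow : (1 + r) ^ m ≤ Real.exp (1 + r) * m.factorial := by
    have := Real.pow_div_factorial_le_exp (1 + r) (by positivity) m
    rwa [div_le_iff₀ (by positivity)] at this
  have hsq : 1 + r - a * r ^ 2 ≤ 1 + 1 / (4 * a) := by
    have : 1 / (4 * a) - r + a * r ^ 2 = (2 * a * r - 1) ^ 2 / (4 * a) := by field_simp; ring
    have : 0 ≤ (2 * a * r - 1) ^ 2 / (4 * a) := by positivity
    linarith
  calc (1 + r) ^ m * Real.exp (-a * r ^ 2)
      ≤ Real.exp (1 + r) * m.factorial * Real.exp (-a * r ^ 2) := by gcongr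
    _ = m.factorial * Real.exp (1 + r - a * r ^ 2) := by
        rw [mul_comm (Real.exp _), mul_assoc, ← Real.exp_add]; ring_nf
    _ ≤ m.factorial * Real.exp (1 + 1 / (4 * a)) := by gcongr

theorem exists_forall_norm_iteratedFDeriv_exp_le {f : V → ℝ} (hf : f.HasTemperateGrowth) (n : ℕ) :
    ∃ (K : ℕ) (C : ℝ), 0 ≤ C ∧ ∀ x, ‖iteratedFDeriv ℝ n (fun x => Real.exp (f x)) x‖ ≤
      C * (1 + ‖x‖) ^ K * Real.exp (f x) := by
  obtain ⟨K, C, hC, hD⟩ := hf.norm_iteratedFDeriv_le_uniform n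
  refine ⟨K * n, n.factorial * (C + 1) ^ n, by positivity, fun x => ?_⟩
  have hone : 1 ≤ (C + 1) * (1 + ‖x‖) ^ K :=
    one_le_mul_of_one_le_of_one_le (by linarith) (one_le_pow₀ (by linarith [norm_nonneg x]))
  have hcomp := norm_iteratedFDeriv_comp_le (𝕜 := ℝ) (g := Real.exp) (n := n) (N := (⊤ : ℕ∞))
    Real.contDiff_exp hf.1 (by exact_mod_cast le_top) x (C := Real.exp (f x))
    (D := (C + 1) * (1 + ‖x‖) ^ K)
    (fun i _ => by
      rw [norm_iteratedFDeriv_eq_norm_iteratedDeriv, iteratedDeriv_eq_iterate,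
        Real.iter_deriv_exp, Real.norm_eq_abs, Real.abs_exp])
    (fun i hi hin => calc
      ‖iteratedFDeriv ℝ i f x‖ ≤ C * (1 + ‖x‖) ^ K := hD i hin x
      _ ≤ (C + 1) * (1 + ‖x‖) ^ K := by gcongr; linarith
      _ ≤ ((C + 1) * (1 + ‖x‖) ^ K) ^ i := le_self_pow₀ hone (by omega))
  refine hcomp.trans_eq ?_
  rw [mul_pow, ← pow_mul]
  ring

/-- The real Gaussian `x ↦ exp (-a ‖x‖²)` as a Schwartz function. -/
noncomputable def realGaussian (a : ℝ) (ha : 0 < a) : 𝓢(V, ℝ) where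
  toFun x := Real.exp (-a * ‖x‖ ^ 2)
  smooth' := Real.contDiff_exp.comp (contDiff_const.mul (contDiff_norm_sq ℝ))
  decay' k n := by
    have hquad : (fun x : V => -a * ‖x‖ ^ 2).HasTemperateGrowth :=
      (Function.HasTemperateGrowth.const (-a)).mul (Function.hasTemperateGrowth_norm_sq V)
    obtain ⟨K, C, hC, hderiv⟩ := exists_forall_norm_iteratedFDeriv_exp_le hquad n
    obtain ⟨B, hB⟩ := exists_forall_one_add_pow_mul_exp_le ha (k + K)
    refine ⟨C * B, fun x => ?_⟩
    calc ‖x‖ ^ k * ‖iteratedFDeriv ℝ n (fun x : V => Real.exp (-a * ‖x‖ ^ 2)) x‖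
        ≤ (1 + ‖x‖) ^ k * (C * (1 + ‖x‖) ^ K * Real.exp (-a * ‖x‖ ^ 2)) := by
          gcongr
          · linarith
          · exact hderiv x
      _ = C * ((1 + ‖x‖) ^ (k + K) * Real.exp (-a * ‖x‖ ^ 2)) := by ring
      _ ≤ C * B := by gcongr; exact hB _ (norm_nonneg x)

/-- The Gaussian `x ↦ exp (-a ‖x‖²)` as a complex-valued Schwartz function. -/
noncomputable def gaussian (a : ℝ) (ha : 0 < a) : 𝓢(V, ℂ) :=
  (realGaussian a ha).postcompCLM Complex.ofRealCLM

theorem gaussian_apply {a : ℝ} (ha : 0 < a) (x : V) :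
    gaussian a ha x = (Real.exp (-a * ‖x‖ ^ 2) : ℝ) := rfl

theorem norm_gaussian_apply {a : ℝ} (ha : 0 < a) (x : V) :
    ‖gaussian a ha x‖ = Real.exp (-a * ‖x‖ ^ 2) := by
  rw [gaussian_apply, Complex.norm_real, Real.norm_eq_abs, Real.abs_exp]

theorem norm_gaussian_apply_le_one {a : ℝ} (ha : 0 < a) (x : V) : ‖gaussian a ha x‖ ≤ 1 := by
  rw [norm_gaussian_apply, Real.exp_le_one_iff, neg_mul, neg_nonpos]
  positivity

variable [FiniteDimensional ℝ V] [MeasurableSpace V] [BorelSpace V]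

theorem fourier_gaussian_apply {a : ℝ} (ha : 0 < a) (x : V) :
    𝓕 (gaussian a ha : 𝓢(V, ℂ)) x =
      ((Real.pi / a) ^ ((finrank ℝ V : ℝ) / 2) * Real.exp (-Real.pi ^ 2 * ‖x‖ ^ 2 / a) : ℝ) := by
  have hg : ⇑(gaussian a ha : 𝓢(V, ℂ)) = fun v => Complex.exp (-a * ‖v‖ ^ 2) := by
    ext v
    simp [gaussian_apply]
  rw [SchwartzMap.fourier_coe, hg,
    fourier_gaussian_innerProductSpace (V := V) (b := (a : ℂ)) (by simpa) x]
  push_cast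
  rw [Complex.ofReal_cpow (by positivity)]
  push_cast
  rfl

theorem integral_fourier (f : 𝓢(V, ℂ)) : ∫ x, 𝓕 f x = f 0 := by
  have h : 𝓕⁻ (𝓕 f) (0 : V) = f 0 := by rw [FourierTransform.fourierInv_fourier_eq]
  rw [SchwartzMap.fourierInv_coe, Real.fourierInv_eq] at h
  simpa using h

theorem integral_norm_fourier_gaussian {a : ℝ} (ha : 0 < a) :
    ∫ x, ‖𝓕 (gaussian a ha : 𝓢(V, ℂ)) x‖ = 1 := by
  have hnorm (x : V) : (‖𝓕 (gaussian a ha : 𝓢(V, ℂ)) x‖ : ℂ) = 𝓕 (gaussian a ha : 𝓢(V, ℂ)) x := by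
    rw [fourier_gaussian_apply, Complex.norm_real, Real.norm_of_nonneg (by positivity)]
  rw [← Complex.ofReal_inj, ← integral_complex_ofReal]
  simp_rw [hnorm]
  simp [integral_fourier, gaussian_apply]

theorem fourier_compSubConstCLM_apply (a : V) (f : 𝓢(V, ℂ)) (z : V) :
    𝓕 (SchwartzMap.compSubConstCLM ℂ a f) z = Real.fourierChar (-inner ℝ a z) * 𝓕 f z := by
  rw [SchwartzMap.fourier_coe, SchwartzMap.fourier_coe, Real.fourier_eq, Real.fourier_eq,
    ← integral_add_right_eq_self _ a, ← integral_const_mul]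
  refine integral_congr_ae (ae_of_all _ fun v => ?_)
  have hchar : Real.fourierChar (-inner ℝ (v + a) z) =
      Real.fourierChar (-inner ℝ a z) * Real.fourierChar (-inner ℝ v z) := by
    rw [inner_add_left, neg_add_rev, AddChar.map_add_eq_mul]
  simp only [SchwartzMap.compSubConstCLM_apply, add_sub_cancel_right, hchar, Circle.smul_def,
    Circle.coe_mul, smul_eq_mul, mul_assoc]

/-- The modulated function `ξ ↦ exp (-2πi ⟪ξ, t⟫) f ξ`. Defining it as a translation on the
Fourier side makes it a Schwartz function for free. -/
noncomputable def modulate (t : V) (f : 𝓢(V, ℂ)) : 𝓢(V, ℂ) :=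
  𝓕⁻ (SchwartzMap.compSubConstCLM ℂ (-t) (𝓕 f))

theorem fourier_modulate (t : V) (f : 𝓢(V, ℂ)) :
    𝓕 (modulate t f) = SchwartzMap.compSubConstCLM ℂ (-t) (𝓕 f) := by
  rw [modulate, FourierTransform.fourier_fourierInv_eq]

theorem modulate_apply (t : V) (f : 𝓢(V, ℂ)) (ξ : V) :
    modulate t f ξ = Real.fourierChar (-inner ℝ ξ t) * f ξ := by
  have hinv (g : 𝓢(V, ℂ)) : 𝓕⁻ g ξ = 𝓕 g (-ξ) := by
    rw [SchwartzMap.fourierInv_coe, SchwartzMap.fourier_coe, Real.fourierInv_eq_fourier_neg]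
  rw [modulate, hinv, fourier_compSubConstCLM_apply, ← hinv, FourierTransform.fourierInv_fourier_eq,
    inner_neg_neg, real_inner_comm]

theorem norm_modulate_apply (t : V) (f : 𝓢(V, ℂ)) (ξ : V) : ‖modulate t f ξ‖ = ‖f ξ‖ := by
  rw [modulate_apply, norm_mul, Circle.norm_coe, one_mul]

theorem continuous_uncurry_modulate (f : 𝓢(V, ℂ)) :
    Continuous fun p : V × V => modulate p.1 f p.2 := by
  simp_rw [modulate_apply]
  have := f.continuous
  fun_prop

end SchwartzFunctions

section BochnerSchwartz

open Filter Metric Module Topology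

open scoped ComplexOrder NNReal

theorem integral_withDensity_ofReal {X : Type*} [MeasurableSpace X] {ρ : Measure X} {h : X → ℝ}
    (hm : Measurable h) (h0 : ∀ x, 0 ≤ h x) (f : X → ℂ) :
    ∫ x, f x ∂(ρ.withDensity fun x => ENNReal.ofReal (h x)) = ∫ x, (h x : ℂ) * f x ∂ρ := by
  rw [integral_withDensity_eq_integral_toReal_smul hm.ennreal_ofReal
    (ae_of_all _ fun _ => ENNReal.ofReal_lt_top)]
  exact integral_congr_ae (ae_of_all _ fun x => by simp [ENNReal.toReal_ofReal (h0 x)])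

theorem withDensity_ofReal_inj {X : Type*} [MeasurableSpace X] {σ τ : Measure X} {h : X → ℝ}
    (hm : Measurable h) (h0 : ∀ x, 0 < h x) :
    (σ.withDensity fun x => ENNReal.ofReal (h x)) = τ.withDensity (fun x => ENNReal.ofReal (h x)) ↔
      σ = τ := by
  refine ⟨fun hστ => ?_, fun hστ => hστ ▸ rfl⟩
  have hinv (ρ : Measure X) := withDensity_inv_same (μ := ρ) hm.ennreal_ofReal
    (ae_of_all _ fun x => (ENNReal.ofReal_pos.2 (h0 x)).ne')
    (ae_of_all _ fun _ => ENNReal.ofReal_ne_top)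
  rw [← hinv σ, hστ, hinv]

theorem exists_withDensity_ofReal_eq {X : Type*} [MeasurableSpace X] (ρ : Measure X) {h : X → ℝ}
    (hm : Measurable h) (h0 : ∀ x, 0 < h x) :
    ∃ σ : Measure X, σ.withDensity (fun x => ENNReal.ofReal (h x)) = ρ := by
  refine ⟨ρ.withDensity fun x => (ENNReal.ofReal (h x))⁻¹, ?_⟩
  simpa using withDensity_inv_same (μ := ρ) (f := fun x => (ENNReal.ofReal (h x))⁻¹)
    hm.ennreal_ofReal.inv (ae_of_all _ fun _ => by simp) (ae_of_all _ fun x => by simp [h0 x])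

variable {V : Type*} [NormedAddCommGroup V]

theorem exists_boundedContinuousFunction_polyWeight_mul_eq [NormedSpace ℝ V] (m : ℕ)
    (f : 𝓢(V, ℂ)) :
    ∃ h : BoundedContinuousFunction V ℂ, ∀ x, (polyWeight m x : ℂ) * h x = f x := by
  obtain ⟨M, -, hM⟩ := exists_norm_le_mul_polyWeight f m
  have hw (x : V) : (polyWeight m x : ℂ) ≠ 0 := Complex.ofReal_ne_zero.2 (polyWeight_pos m x).ne'
  refine ⟨BoundedContinuousFunction.ofNormedAddCommGroup (fun x => f x / polyWeight m x)
    (f.continuous.div (Complex.continuous_ofReal.comp (continuous_polyWeight m)) hw) M fun x => ?_,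
    fun x => mul_div_cancel₀ _ (hw x)⟩
  rw [norm_div, Complex.norm_of_nonneg (polyWeight_pos m x).le, div_le_iff₀ (polyWeight_pos m x)]
  exact hM x

variable [MeasurableSpace V] [BorelSpace V]

theorem setLIntegral_compl_closedBall_polyWeight_le (ρ : Measure V) (m : ℕ) {R : ℝ} (hR : 0 ≤ R) :
    ∫⁻ x in (closedBall 0 R)ᶜ, ENNReal.ofReal (polyWeight (m + 1) x) ∂ρ ≤
      ENNReal.ofReal (1 + R)⁻¹ * ∫⁻ x, ENNReal.ofReal (polyWeight m x) ∂ρ := by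
  rw [← lintegral_const_mul _ (continuous_polyWeight m).measurable.ennreal_ofReal]
  refine (setLIntegral_mono' isClosed_closedBall.measurableSet.compl fun x hx => ?_).trans
    (setLIntegral_le_lintegral _ _)
  rw [← ENNReal.ofReal_mul (by positivity)]
  have hx : R < ‖x‖ := by simpa using hx
  rw [polyWeight_eq_inv_pow, polyWeight_eq_inv_pow, ← mul_inv, pow_succ']
  gcongr

theorem exists_tendsto_hyperfilter_of_tight [ProperSpace V] {P : ℕ → FiniteMeasure V} {K : ℝ≥0}
    (hmass : ∀ n, (P n).mass ≤ K) {u : ℕ → ℝ≥0} (hu : Tendsto u atTop (𝓝 0))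
    (htail : ∀ n R : ℕ, P n (closedBall 0 R)ᶜ ≤ u R) :
    ∃ Q, Tendsto P (hyperfilter ℕ) (𝓝 Q) := by
  have hcompact := isCompact_setOfPred_finiteMeasure_mass_le_compl_isCompact_le (E := V)
    (K := fun R : ℕ => closedBall 0 (R : ℝ)) K hu (fun R => isCompact_closedBall _ _)
    (Or.inl inferInstance)
  obtain ⟨Q, -, hQ⟩ := hcompact.ultrafilter_le_nhds (Ultrafilter.map P (hyperfilter ℕ))
    (le_principal_iff.2 (Filter.mem_map.2 (Eventually.of_forall fun n => ⟨hmass n, htail n⟩)))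
  exact ⟨Q, hQ⟩

section NormedSpace

variable [NormedSpace ℝ V] [FiniteDimensional ℝ V]

theorem exists_finiteMeasure_tendsto_polyWeight {σ : ℕ → Measure V} {δ : ℝ} (hδ : 0 < δ) {C : ℝ≥0}
    (hσ : ∀ n, IsTranslationBounded (σ n) δ C) :
    ∃ (P : ℕ → FiniteMeasure V) (Q : FiniteMeasure V),
      (∀ n, (P n : Measure V) = (σ n).withDensity
        fun x => ENNReal.ofReal (polyWeight (finrank ℝ V + 2) x)) ∧
      Tendsto P (hyperfilter ℕ) (𝓝 Q) := by
  obtain ⟨K, hK⟩ := exists_forall_lintegral_polyWeight_le (V := V) hδ C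
  let w (x : V) : ℝ≥0∞ := ENNReal.ofReal (polyWeight (finrank ℝ V + 2) x)
  have hmass (n : ℕ) : ∫⁻ x, w x ∂(σ n) ≤ K := by
    refine (lintegral_mono fun x => ENNReal.ofReal_le_ofReal ?_).trans (hK _ (hσ n))
    rw [polyWeight_eq_inv_pow, polyWeight_eq_inv_pow]
    gcongr <;> simp
  have htail (n R : ℕ) : (σ n).withDensity w (closedBall 0 R)ᶜ ≤
      ((K * (1 + R : ℝ)⁻¹.toNNReal : ℝ≥0) : ℝ≥0∞) := by
    rw [withDensity_apply _ isClosed_closedBall.measurableSet.compl, ENNReal.coe_mul, mul_comm]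
    refine (setLIntegral_compl_closedBall_polyWeight_le _ _ R.cast_nonneg).trans ?_
    gcongr
    exacts [le_rfl, hK _ (hσ n)]
  let P (n : ℕ) : FiniteMeasure V :=
    ⟨(σ n).withDensity w, isFiniteMeasure_withDensity (ne_top_of_le_ne_top (by simp) (hmass n))⟩
  have htendsto : Tendsto (fun R : ℕ => K * (1 + R : ℝ)⁻¹.toNNReal) atTop (𝓝 0) := by
    have := (tendsto_real_toNNReal tendsto_one_div_add_atTop_nhds_zero_nat).const_mul K
    simpa [add_comm] using this
  have hPmass (n : ℕ) : (P n).mass ≤ K := by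
    rw [← ENNReal.coe_le_coe, FiniteMeasure.ennreal_mass]
    simpa [P] using hmass n
  have hPtail (n R : ℕ) : P n (closedBall 0 R)ᶜ ≤ K * (1 + R : ℝ)⁻¹.toNNReal := by
    rw [← ENNReal.coe_le_coe, FiniteMeasure.ennreal_coeFn_eq_coeFn_toMeasure]
    exact htail n R
  obtain ⟨Q, hQ⟩ := exists_tendsto_hyperfilter_of_tight hPmass htendsto hPtail
  exact ⟨P, Q, fun _ => rfl, hQ⟩

theorem exists_forall_integral_eq_of_tendsto {σ : ℕ → Measure V} {δ : ℝ} (hδ : 0 < δ) {C : ℝ≥0}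
    (hσ : ∀ n, IsTranslationBounded (σ n) δ C) {L : 𝓢(V, ℂ) → ℂ}
    (hL : ∀ f : 𝓢(V, ℂ), Tendsto (fun n => ∫ x, f x ∂(σ n)) atTop (𝓝 (L f))) :
    ∃ τ : Measure V, τ.HasTemperateGrowth ∧ ∀ f : 𝓢(V, ℂ), ∫ x, f x ∂τ = L f := by
  obtain ⟨P, Q, hP, hPQ⟩ := exists_finiteMeasure_tendsto_polyWeight hδ hσ
  set m := finrank ℝ V + 2
  have hw : Measurable (polyWeight m : V → ℝ) := (continuous_polyWeight _).measurable
  obtain ⟨τ, hτ⟩ := exists_withDensity_ofReal_eq (Q : Measure V) hw (polyWeight_pos _)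
  refine ⟨τ, ⟨m, lintegral_polyWeight_ne_top_iff.1 ?_⟩, fun f => ?_⟩
  · rw [← setLIntegral_univ, ← withDensity_apply _ MeasurableSet.univ, hτ]
    exact measure_ne_top _ _
  obtain ⟨h, hh⟩ := exists_boundedContinuousFunction_polyWeight_mul_eq m f
  have hint (ρ : Measure V) : ∫ x, h x ∂(ρ.withDensity fun x => ENNReal.ofReal (polyWeight m x)) =
      ∫ x, f x ∂ρ := by
    simp_rw [integral_withDensity_ofReal hw fun x => (polyWeight_pos m x).le, hh]
  rw [FiniteMeasure.tendsto_iff_forall_integral_rclike_tendsto ℂ] at hPQ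
  have hlim := hPQ h
  simp_rw [hP, ← hτ, hint] at hlim
  exact tendsto_nhds_unique hlim ((hL f).mono_left Nat.hyperfilter_le_atTop)

end NormedSpace

section InnerProductSpace

variable [InnerProductSpace ℝ V] [FiniteDimensional ℝ V]

theorem charFun_withDensity_gaussian (ρ : Measure V) (t : V) :
    charFun (ρ.withDensity fun x => ENNReal.ofReal (Real.exp (-1 * ‖x‖ ^ 2))) t =
      ∫ x, modulate (-(2 * Real.pi)⁻¹ • t) (gaussian 1 one_pos) x ∂ρ := by
  rw [charFun_apply, integral_withDensity_ofReal (by fun_prop) fun x => (Real.exp_pos _).le]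
  refine integral_congr_ae (ae_of_all _ fun x => ?_)
  simp only [modulate_apply, gaussian_apply, Real.fourierChar_apply, inner_smul_right]
  rw [mul_comm]
  congr 3
  push_cast
  field_simp [Real.pi_ne_zero]

theorem measure_eq_of_forall_integral_schwartz_eq {σ τ : Measure V} (hσ : σ.HasTemperateGrowth)
    (hτ : τ.HasTemperateGrowth) (h : ∀ f : 𝓢(V, ℂ), ∫ x, f x ∂σ = ∫ x, f x ∂τ) : σ = τ := by
  have hfinite (ρ : Measure V) (hρ : ρ.HasTemperateGrowth) : IsFiniteMeasure
      (ρ.withDensity fun x => ENNReal.ofReal (Real.exp (-1 * ‖x‖ ^ 2))) :=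
    isFiniteMeasure_withDensity_ofReal ((realGaussian 1 one_pos).integrable (μ := ρ)).2
  have := hfinite σ hσ
  have := hfinite τ hτ
  rw [← withDensity_ofReal_inj (h := fun x : V => Real.exp (-1 * ‖x‖ ^ 2)) (by fun_prop)
    fun x => Real.exp_pos _]
  refine Measure.ext_of_charFun (funext fun t => ?_)
  rw [charFun_withDensity_gaussian, charFun_withDensity_gaussian, h]

theorem measure_ball_one_le_norm_integral_gaussian (ρ : Measure V) [ρ.HasTemperateGrowth] (a : V) :
    ρ (ball a 1) ≤ ENNReal.ofReal (Real.exp 1 *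
      ‖∫ x, SchwartzMap.compSubConstCLM ℂ a (gaussian 1 one_pos) x ∂ρ‖) := by
  let g : 𝓢(V, ℂ) := SchwartzMap.compSubConstCLM ℂ a (gaussian 1 one_pos)
  have hg (x : V) : g x = (‖g x‖ : ℂ) := by
    simp only [g, SchwartzMap.compSubConstCLM_apply, norm_gaussian_apply]
    rfl
  calc ρ (ball a 1) = ∫⁻ _ in ball a 1, 1 ∂ρ := (setLIntegral_one _).symm
    _ ≤ ∫⁻ x, ENNReal.ofReal (Real.exp 1 * ‖g x‖) ∂ρ := by
      refine (setLIntegral_mono' isOpen_ball.measurableSet fun x hx => ?_).trans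
        (setLIntegral_le_lintegral _ _)
      rw [mem_ball_iff_norm] at hx
      rw [SchwartzMap.compSubConstCLM_apply, norm_gaussian_apply, ← Real.exp_add,
        ENNReal.one_le_ofReal, Real.one_le_exp_iff]
      nlinarith [norm_nonneg (x - a)]
    _ = ENNReal.ofReal (Real.exp 1 * ∫ x, ‖g x‖ ∂ρ) := by
      rw [← integral_const_mul, ofReal_integral_eq_lintegral_ofReal
        ((g.integrable (μ := ρ)).norm.const_mul _) (ae_of_all _ fun x => by positivity)]
    _ = ENNReal.ofReal (Real.exp 1 * ‖∫ x, g x ∂ρ‖) := by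
      rw [integral_congr_ae (ae_of_all ρ hg), integral_complex_ofReal,
        Complex.norm_of_nonneg (integral_nonneg fun x => norm_nonneg _)]

variable {ω : Measure V}

theorem integral_mul_integral_modulate [SFinite ω] [ω.HasTemperateGrowth] (f g : 𝓢(V, ℂ)) :
    ∫ k, f k * ∫ z, modulate k g z ∂ω = ∫ z, g z * 𝓕 f z ∂ω := by
  have hint : Integrable (fun p : V × V => f p.1 * modulate p.1 g p.2) (volume.prod ω) := by
    refine (f.integrable.mul_prod (g.integrable (μ := ω))).mono
      ((f.continuous.comp continuous_fst).mul
        (continuous_uncurry_modulate g)).aestronglyMeasurable (ae_of_all _ fun p => ?_)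
    simp [norm_modulate_apply]
  simp_rw [← integral_const_mul]
  rw [integral_integral_swap hint]
  refine integral_congr_ae (ae_of_all _ fun z => ?_)
  simp only [SchwartzMap.fourier_coe, Real.fourier_eq]
  rw [← integral_const_mul]
  refine integral_congr_ae (ae_of_all _ fun k => ?_)
  simp only [modulate_apply, Circle.smul_def, smul_eq_mul, real_inner_comm k z]
  ring

theorem exists_integral_eq_integral_mul_fourier [SFinite ω] [ω.HasTemperateGrowth] {g : 𝓢(V, ℂ)}
    (hg : ∀ k, 0 ≤ ∫ z, modulate k g z ∂ω) :
    ∃ σ : Measure V, σ.HasTemperateGrowth ∧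
      ∀ f : 𝓢(V, ℂ), ∫ k, f k ∂σ = ∫ z, g z * 𝓕 f z ∂ω := by
  let S (k : V) : ℝ := (∫ z, modulate k g z ∂ω).re
  have hS0 (k : V) : 0 ≤ S k := (Complex.nonneg_iff.1 (hg k)).1
  have hS (k : V) : (S k : ℂ) = ∫ z, modulate k g z ∂ω :=
    Complex.ext rfl (Complex.nonneg_iff.1 (hg k)).2
  have hSm : Measurable S := Complex.measurable_re.comp
    (continuous_uncurry_modulate g).stronglyMeasurable.integral_prod_right'.measurable
  have hSle (k : V) : S k ≤ ∫ z, ‖g z‖ ∂ω := by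
    refine (Complex.re_le_norm _).trans ((norm_integral_le_integral_norm _).trans_eq ?_)
    simp_rw [norm_modulate_apply]
  have hbounded : IsTranslationBounded (volume.withDensity fun k => ENNReal.ofReal (S k)) 1
      (ENNReal.ofReal (∫ z, ‖g z‖ ∂ω) * volume (ball (0 : V) 1)).toNNReal := fun a => by
    rw [ENNReal.coe_toNNReal (by finiteness), withDensity_apply _ isOpen_ball.measurableSet,
      ← Measure.addHaar_ball_center volume a, ← setLIntegral_const]
    gcongr
    exact hSle _
  refine ⟨_, hbounded.hasTemperateGrowth one_pos, fun f => ?_⟩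
  rw [integral_withDensity_ofReal hSm hS0, ← integral_mul_integral_modulate]
  simp_rw [hS, mul_comm]

theorem isTranslationBounded_of_integral_eq_integral_mul_fourier [ω.HasTemperateGrowth]
    {σ : Measure V} [σ.HasTemperateGrowth] {g : 𝓢(V, ℂ)} (hg : ∀ z, ‖g z‖ ≤ 1)
    (h : ∀ f : 𝓢(V, ℂ), ∫ k, f k ∂σ = ∫ z, g z * 𝓕 f z ∂ω) :
    IsTranslationBounded σ 1
      (Real.exp 1 * ∫ z, ‖𝓕 (gaussian 1 one_pos : 𝓢(V, ℂ)) z‖ ∂ω).toNNReal := fun a => by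
  refine (measure_ball_one_le_norm_integral_gaussian σ a).trans ?_
  rw [← ENNReal.ofReal]
  gcongr
  rw [h]
  refine norm_integral_le_of_norm_le (SchwartzMap.integrable _).norm (ae_of_all _ fun z => ?_)
  rw [norm_mul, fourier_compSubConstCLM_apply, norm_mul, Circle.norm_coe, one_mul]
  exact mul_le_of_le_one_left (norm_nonneg _) (hg z)

theorem tendsto_integral_gaussian_mul [ω.HasTemperateGrowth] (f : 𝓢(V, ℂ)) :
    Tendsto (fun n : ℕ => ∫ z, gaussian (1 / ((n : ℝ) + 1)) Nat.one_div_pos_of_nat z * f z ∂ω)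
      atTop (𝓝 (∫ z, f z ∂ω)) := by
  refine tendsto_integral_of_dominated_convergence (fun z => ‖f z‖)
    (fun n => ((SchwartzMap.continuous _).mul f.continuous).aestronglyMeasurable)
    (f.integrable (μ := ω)).norm (fun n => ae_of_all _ fun z => ?_) (ae_of_all _ fun z => ?_)
  · rw [norm_mul]
    exact mul_le_of_le_one_left (norm_nonneg _) (norm_gaussian_apply_le_one _ z)
  · have hcont : Continuous fun b : ℝ => (Real.exp (-b * ‖z‖ ^ 2) : ℂ) * f z := by fun_prop
    simpa [gaussian_apply, Function.comp_def] using
      (hcont.tendsto 0).comp tendsto_one_div_add_atTop_nhds_zero_nat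

theorem exists_integral_eq_integral_fourier_of_modulate_gaussian_nonneg [SFinite ω]
    [ω.HasTemperateGrowth]
    (hpos : ∀ (b : ℝ) (hb : 0 < b) (k : V), 0 ≤ ∫ z, modulate k (gaussian b hb) z ∂ω) :
    ∃ σ : Measure V, σ.HasTemperateGrowth ∧ ∀ f : 𝓢(V, ℂ), ∫ k, f k ∂σ = ∫ z, 𝓕 f z ∂ω := by
  choose σ hσ hσf using fun n : ℕ =>
    exists_integral_eq_integral_mul_fourier (hpos (1 / ((n : ℝ) + 1)) Nat.one_div_pos_of_nat)
  refine exists_forall_integral_eq_of_tendsto one_pos (fun n =>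
    isTranslationBounded_of_integral_eq_integral_mul_fourier (norm_gaussian_apply_le_one _)
      (hσf n)) fun f => ?_
  simpa only [hσf] using tendsto_integral_gaussian_mul (𝓕 f)

end InnerProductSpace

theorem existsUnique_isFourierTransform_of_modulate_gaussian_nonneg {d : ℕ}
    {ω : Measure (Space d)} [SFinite ω] (hω : ω.HasTemperateGrowth)
    (hpos : ∀ (b : ℝ) (hb : 0 < b) (k : Space d), 0 ≤ ∫ z, modulate k (gaussian b hb) z ∂ω) :
    ∃! σ, IsFourierTransform ω σ := by
  obtain ⟨σ, hσ, hσf⟩ := exists_integral_eq_integral_fourier_of_modulate_gaussian_nonneg hpos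
  exact ⟨σ, ⟨hω, hσ, hσf⟩, fun τ hτ => measure_eq_of_forall_integral_schwartz_eq
    hτ.temperate_right hσ fun f => by rw [hτ.integral_eq, hσf]⟩

end BochnerSchwartz

section LinearStatistics

open PointMeasure ProbabilityTheory

open scoped ComplexOrder NNReal

variable {d : ℕ}

theorem exists_forall_lintegral_enorm_le {V F : Type*} [NormedAddCommGroup V] [NormedSpace ℝ V]
    [FiniteDimensional ℝ V] [MeasurableSpace V] [BorelSpace V] [NormedAddCommGroup F]
    [NormedSpace ℝ F] (φ : 𝓢(V, F)) {δ : ℝ} (hδ : 0 < δ) (C : ℝ≥0) :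
    ∃ B : ℝ≥0, ∀ ρ : Measure V, IsTranslationBounded ρ δ C → ∫⁻ x, ‖φ x‖ₑ ∂ρ ≤ B := by
  let m := Module.finrank ℝ V + 1
  obtain ⟨K, hK⟩ := exists_forall_lintegral_polyWeight_le (V := V) hδ C
  obtain ⟨M, hM, hφ⟩ := exists_norm_le_mul_polyWeight φ m
  refine ⟨M.toNNReal * K, fun ρ hρ => ?_⟩
  calc ∫⁻ x, ‖φ x‖ₑ ∂ρ ≤ ∫⁻ x, ENNReal.ofReal M * ENNReal.ofReal (polyWeight m x) ∂ρ := by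
        refine lintegral_mono fun x => ?_
        rw [← ENNReal.ofReal_mul hM, ← ofReal_norm]
        exact ENNReal.ofReal_le_ofReal (hφ x)
    _ = ENNReal.ofReal M * ∫⁻ x, ENNReal.ofReal (polyWeight m x) ∂ρ :=
        lintegral_const_mul _ (continuous_polyWeight m).measurable.ennreal_ofReal
    _ ≤ (M.toNNReal * K : ℝ≥0) := by
        rw [ENNReal.coe_mul, ENNReal.ofReal]
        gcongr
        exact hK ρ hρ

instance (μ : Measure (PointMeasure d)) [SFinite μ] : SFinite (autocorrelation μ) := by
  rw [autocorrelation_eq_map_secondMoment]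
  infer_instance

theorem hasTemperateGrowth_autocorrelation {μ : Measure (PointMeasure d)} [IsFiniteMeasure μ]
    {r : ℝ} (hr : 0 < r) (hμ : ∀ᵐ ν ∂μ, IsUniformlyDiscrete r ν) :
    (autocorrelation μ).HasTemperateGrowth := by
  obtain ⟨C, hC⟩ := exists_isTranslationBounded_autocorrelation hr hμ
  exact hC.hasTemperateGrowth (half_pos hr)

theorem IsStationaryLaw.secondMoment_eq_map_prod {μ : Measure (PointMeasure d)} [SFinite μ]
    (hμ : IsStationaryLaw μ) : secondMoment μ =
      ((autocorrelation μ).prod volume).map fun p => (p.2, p.2 + p.1) := by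
  refine Measure.ext_of_lintegral _ fun F hF => ?_
  rw [hμ.lintegral_secondMoment hF, lintegral_map hF (by fun_prop),
    lintegral_prod _ (by fun_prop)]

/-- The linear statistic `ν ↦ ∫ φ dν` of a point measure. -/
noncomputable def linearStatistic (φ : 𝓢(Space d, ℂ)) (ν : PointMeasure d) : ℂ :=
  ∫ x, φ x ∂ν.toMeasure

theorem stronglyMeasurable_linearStatistic (φ : 𝓢(Space d, ℂ)) :
    StronglyMeasurable (linearStatistic φ) :=
  StronglyMeasurable.integral_kernel (κ := kernel d) φ.continuous.stronglyMeasurable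

theorem linearStatistic_translate (φ : 𝓢(Space d, ℂ)) (t : Space d) (ν : PointMeasure d) :
    linearStatistic φ (translate t ν) =
      linearStatistic (SchwartzMap.compSubConstCLM ℂ (-t) φ) ν := by
  rw [linearStatistic, integral_translate]
  exact integral_congr_ae (ae_of_all _ fun x => by simp [add_comm])

variable {μ : Measure (PointMeasure d)} [IsFiniteMeasure μ] {r : ℝ}

theorem memLp_linearStatistic (hr : 0 < r) (hμ : ∀ᵐ ν ∂μ, IsUniformlyDiscrete r ν)
    (φ : 𝓢(Space d, ℂ)) (p : ℝ≥0∞) : MemLp (linearStatistic φ) p μ := by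
  obtain ⟨B, hB⟩ := exists_forall_lintegral_enorm_le φ (half_pos hr) 1
  refine MemLp.of_bound (stronglyMeasurable_linearStatistic φ).aestronglyMeasurable B
    (hμ.mono fun ν hν => ?_)
  exact NNReal.coe_le_coe.2 <| enorm_le_coe.1 <|
    (enorm_integral_le_lintegral_enorm _).trans (hB _ hν.isTranslationBounded)

theorem integrable_conj_mul_secondMoment (hr : 0 < r) (hμ : ∀ᵐ ν ∂μ, IsUniformlyDiscrete r ν)
    (φ ψ : 𝓢(Space d, ℂ)) :
    Integrable (fun p => starRingEnd ℂ (φ p.1) * ψ p.2) (secondMoment μ) := by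
  have hcont : Continuous fun p : Space d × Space d => starRingEnd ℂ (φ p.1) * ψ p.2 := by
    have := φ.continuous
    have := ψ.continuous
    fun_prop
  refine ⟨hcont.aestronglyMeasurable, ?_⟩
  obtain ⟨A, hA⟩ := exists_forall_lintegral_enorm_le φ (half_pos hr) 1
  obtain ⟨B, hB⟩ := exists_forall_lintegral_enorm_le ψ (half_pos hr) 1
  rw [HasFiniteIntegral, lintegral_secondMoment μ hcont.measurable.enorm]
  calc ∫⁻ ν, ∫⁻ x, ∫⁻ y, ‖starRingEnd ℂ (φ x) * ψ y‖ₑ ∂ν.toMeasure ∂ν.toMeasure ∂μ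
      ≤ ∫⁻ _, A * B ∂μ := by
        refine lintegral_mono_ae (hμ.mono fun ν hν => ?_)
        simp_rw [enorm_mul, RCLike.enorm_conj,
          lintegral_const_mul _ ψ.continuous.measurable.enorm]
        rw [lintegral_mul_const _ φ.continuous.measurable.enorm]
        gcongr
        exacts [hA _ hν.isTranslationBounded, hB _ hν.isTranslationBounded]
    _ < ∞ := by
        rw [lintegral_const]
        finiteness

theorem integral_conj_linearStatistic_mul_eq_secondMoment (hr : 0 < r)
    (hμ : ∀ᵐ ν ∂μ, IsUniformlyDiscrete r ν) (φ ψ : 𝓢(Space d, ℂ)) :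
    ∫ ν, starRingEnd ℂ (linearStatistic φ ν) * linearStatistic ψ ν ∂μ =
      ∫ p, starRingEnd ℂ (φ p.1) * ψ p.2 ∂(secondMoment μ) := by
  have hint := integrable_conj_mul_secondMoment hr hμ φ ψ
  rw [secondMoment, Measure.comp_eq_comp_const_apply] at hint ⊢
  rw [Kernel.integral_comp hint, Kernel.const_apply]
  refine integral_congr_ae (ae_of_all _ fun ν => ?_)
  simp only [Kernel.prod_apply, kernel_apply]
  rw [integral_prod_mul (fun x => starRingEnd ℂ (φ x)) ψ, integral_conj]
  rfl

theorem IsStationaryLaw.integral_conj_linearStatistic_mul (hst : IsStationaryLaw μ) (hr : 0 < r)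
    (hμ : ∀ᵐ ν ∂μ, IsUniformlyDiscrete r ν) (φ ψ : 𝓢(Space d, ℂ)) :
    ∫ ν, starRingEnd ℂ (linearStatistic φ ν) * linearStatistic ψ ν ∂μ =
      ∫ z, ∫ x, starRingEnd ℂ (φ x) * ψ (x + z) ∂volume ∂(autocorrelation μ) := by
  have hint := integrable_conj_mul_secondMoment hr hμ φ ψ
  have hm : Measurable fun p : Space d × Space d => (p.2, p.2 + p.1) := by fun_prop
  rw [integral_conj_linearStatistic_mul_eq_secondMoment hr hμ]
  rw [hst.secondMoment_eq_map_prod] at hint ⊢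
  rw [integral_map hm.aemeasurable hint.aestronglyMeasurable]
  exact integral_prod _ (hint.comp_measurable hm)

theorem integral_conj_modulate_gaussian_mul {V : Type*} [NormedAddCommGroup V]
    [InnerProductSpace ℝ V] [FiniteDimensional ℝ V] [MeasurableSpace V] [BorelSpace V] {b : ℝ}
    (hb : 0 < b) (k z : V) :
    ∫ x, starRingEnd ℂ (modulate k (gaussian (2 * b) (by positivity)) x) *
        modulate k (gaussian (2 * b) (by positivity)) (x + z) =
      ((∫ x : V, Real.exp (-(4 * b) * ‖x‖ ^ 2) : ℝ) : ℂ) * modulate k (gaussian b hb) z := by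
  have h (x : V) : starRingEnd ℂ (modulate k (gaussian (2 * b) (by positivity)) x) *
      modulate k (gaussian (2 * b) (by positivity)) (x + z) =
      (Real.exp (-(4 * b) * ‖x + (2⁻¹ : ℝ) • z‖ ^ 2) : ℝ) * modulate k (gaussian b hb) z := by
    have hnorm : -(2 * b) * ‖x‖ ^ 2 + -(2 * b) * ‖x + z‖ ^ 2 =
        -(4 * b) * ‖x + (2⁻¹ : ℝ) • z‖ ^ 2 + -b * ‖z‖ ^ 2 := by
      rw [norm_add_sq_real, norm_add_sq_real, inner_smul_right, norm_smul]
      norm_num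
      ring
    have hchar : starRingEnd ℂ (Real.fourierChar (-inner ℝ x k) : ℂ) *
        Real.fourierChar (-inner ℝ (x + z) k) = Real.fourierChar (-inner ℝ z k) := by
      rw [inner_add_left, neg_add, AddChar.map_add_eq_mul, Circle.coe_mul, ← mul_assoc,
        ← Complex.normSq_eq_conj_mul_self]
      simp
    simp only [modulate_apply, gaussian_apply, map_mul, Complex.conj_ofReal]
    rw [mul_mul_mul_comm, hchar, ← Complex.ofReal_mul, ← Real.exp_add, hnorm, Real.exp_add,
      Complex.ofReal_mul]
    ring
  simp_rw [h]
  rw [integral_mul_const, integral_complex_ofReal,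
    integral_add_right_eq_self (fun x : V => Real.exp (-(4 * b) * ‖x‖ ^ 2))]

theorem IsStationaryLaw.integral_modulate_gaussian_nonneg (hst : IsStationaryLaw μ) (hr : 0 < r)
    (hμ : ∀ᵐ ν ∂μ, IsUniformlyDiscrete r ν) (b : ℝ) (hb : 0 < b) (k : Space d) :
    0 ≤ ∫ z, modulate k (gaussian b hb) z ∂(autocorrelation μ) := by
  let φ : 𝓢(Space d, ℂ) := modulate k (gaussian (2 * b) (by positivity))
  have hvar := hst.integral_conj_linearStatistic_mul hr hμ φ φ
  simp_rw [φ, integral_conj_modulate_gaussian_mul hb, ← Complex.normSq_eq_conj_mul_self] at hvar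
  rw [integral_const_mul, integral_complex_ofReal] at hvar
  have hconst : 0 < ∫ x : Space d, Real.exp (-(4 * b) * ‖x‖ ^ 2) := by
    rw [GaussianFourier.integral_rexp_neg_mul_sq_norm (by positivity)]
    positivity
  refine le_of_mul_le_mul_left ?_ (Complex.zero_lt_real.2 hconst)
  rw [mul_zero, ← hvar, Complex.zero_le_real]
  exact integral_nonneg fun ν => Complex.normSq_nonneg _

theorem IsStationaryLaw.existsUnique_isFourierTransform_autocorrelation (hst : IsStationaryLaw μ)
    (hr : 0 < r) (hμ : ∀ᵐ ν ∂μ, IsUniformlyDiscrete r ν) :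
    ∃! σ, IsFourierTransform (autocorrelation μ) σ :=
  existsUnique_isFourierTransform_of_modulate_gaussian_nonneg
    (hasTemperateGrowth_autocorrelation hr hμ) (hst.integral_modulate_gaussian_nonneg hr hμ)

section SchwartzNormSq

variable {V : Type*} [NormedAddCommGroup V] [InnerProductSpace ℝ V]

/-- The squared modulus of a Schwartz function, as a Schwartz function. -/
noncomputable def schwartzNormSq (f : 𝓢(V, ℂ)) : 𝓢(V, ℂ) :=
  SchwartzMap.pairing (ContinuousLinearMap.mul ℂ ℂ)
    (SchwartzMap.postcompCLM (𝕜 := ℝ) (Complex.conjCLE : ℂ →L[ℝ] ℂ) f) f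

theorem schwartzNormSq_apply (f : 𝓢(V, ℂ)) (x : V) :
    schwartzNormSq f x = starRingEnd ℂ (f x) * f x := by
  rw [schwartzNormSq, SchwartzMap.pairing_apply_apply]
  rfl

theorem integral_conj_fourier_mul [FiniteDimensional ℝ V] [MeasurableSpace V] [BorelSpace V]
    (f : 𝓢(V, ℂ)) (z : V) :
    ∫ x, starRingEnd ℂ (𝓕 f x) * 𝓕 f (x + z) = 𝓕 (schwartzNormSq f) z := by
  have hmod (x : V) : 𝓕 f (x + z) = 𝓕 (modulate z f) x := by
    rw [fourier_modulate, SchwartzMap.compSubConstCLM_apply, sub_neg_eq_add]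
  have hplancherel := SchwartzMap.integral_inner_fourier_fourier f (modulate z f)
  simp only [RCLike.inner_apply] at hplancherel
  simp_rw [hmod, mul_comm (starRingEnd ℂ _), hplancherel]
  rw [SchwartzMap.fourier_coe, Real.fourier_eq]
  refine integral_congr_ae (ae_of_all _ fun ξ => ?_)
  simp only [modulate_apply, schwartzNormSq_apply, Circle.smul_def, smul_eq_mul]
  ring

end SchwartzNormSq

theorem IsStationaryLaw.eLpNorm_linearStatistic_fourier (hst : IsStationaryLaw μ) (hr : 0 < r)
    (hμ : ∀ᵐ ν ∂μ, IsUniformlyDiscrete r ν) {σ : Measure (Space d)}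
    (hσ : IsFourierTransform (autocorrelation μ) σ) (f : 𝓢(Space d, ℂ)) :
    eLpNorm (linearStatistic (𝓕 f)) 2 μ = eLpNorm f 2 σ := by
  have := hσ.temperate_right
  have hvar : ∫ ν, ‖linearStatistic (𝓕 f) ν‖ ^ 2 ∂μ = ∫ k, ‖f k‖ ^ 2 ∂σ := by
    have := hst.integral_conj_linearStatistic_mul hr hμ (𝓕 f) (𝓕 f)
    simp_rw [integral_conj_fourier_mul, ← hσ.integral_eq, schwartzNormSq_apply,
      ← Complex.normSq_eq_conj_mul_self, Complex.normSq_eq_norm_sq, integral_complex_ofReal,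
      Complex.ofReal_inj] at this
    exact this
  rw [MemLp.eLpNorm_eq_integral_rpow_norm two_ne_zero ENNReal.ofNat_ne_top
      (memLp_linearStatistic hr hμ _ _),
    MemLp.eLpNorm_eq_integral_rpow_norm two_ne_zero ENNReal.ofNat_ne_top (f.memLp 2 σ)]
  simp [hvar]

end LinearStatistics

section SpectralIsometry

open PointMeasure Filter Topology

theorem exists_linearIsometry_apply_eq {𝕜 E E' F : Type*} [NontriviallyNormedField 𝕜]
    [AddCommGroup E] [Module 𝕜 E] [NormedAddCommGroup E'] [NormedSpace 𝕜 E']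
    [NormedAddCommGroup F] [NormedSpace 𝕜 F] [CompleteSpace F] {f : E →ₗ[𝕜] F} {e : E →ₗ[𝕜] E'}
    (he : DenseRange e) (hfe : ∀ x, ‖f x‖ = ‖e x‖) :
    ∃ W : E' →ₗᵢ[𝕜] F, ∀ x, W (e x) = f x := by
  have hW := LinearMap.extendOfNorm_eq he ⟨1, fun x => (hfe x).trans_le (one_mul _).ge⟩
  refine ⟨⟨f.extendOfNorm e, fun y => ?_⟩, hW⟩
  refine he.induction_on y (isClosed_eq (by fun_prop) (by fun_prop)) fun x => ?_
  exact (congrArg norm (hW x)).trans (hfe x)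

theorem tendsto_eLpNorm_zero_of_dominated {α E F : Type*} {m : MeasurableSpace α}
    [NormedAddCommGroup E] [NormedAddCommGroup F] {ρ : Measure α} {p : ℝ≥0∞} (hp : p ≠ ∞)
    {g : ℕ → α → E} {b : α → F} (hg : ∀ n, AEStronglyMeasurable (g n) ρ) (hb : MemLp b p ρ)
    (hgb : ∀ n, ∀ᵐ x ∂ρ, ‖g n x‖ ≤ ‖b x‖)
    (hlim : ∀ᵐ x ∂ρ, Tendsto (fun n => g n x) atTop (𝓝 0)) :
    Tendsto (fun n => eLpNorm (g n) p ρ) atTop (𝓝 0) := by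
  rcases eq_or_ne p 0 with rfl | hp0
  · simp
  have hpos : 0 < p.toReal := ENNReal.toReal_pos hp0 hp
  have hint : Tendsto (fun n => ∫⁻ x, ‖g n x‖ₑ ^ p.toReal ∂ρ) atTop (𝓝 (∫⁻ _, 0 ∂ρ)) := by
    refine tendsto_lintegral_of_dominated_convergence' (fun x => ‖b x‖ₑ ^ p.toReal)
      (fun n => (hg n).enorm.pow_const _) (fun n => (hgb n).mono fun x hx => ?_)
      (lintegral_rpow_enorm_lt_top_of_eLpNorm_lt_top hp0 hp hb.eLpNorm_lt_top).ne
      (hlim.mono fun x hx => ?_)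
    · exact ENNReal.rpow_le_rpow (enorm_le_iff_norm_le.2 hx) hpos.le
    · simpa [hpos] using hx.enorm.ennrpow_const p.toReal
  simp_rw [eLpNorm_eq_lintegral_rpow_enorm_toReal hp0 hp]
  simpa [hpos] using hint.ennrpow_const (1 / p.toReal)

instance {V : Type*} [NormedAddCommGroup V] [MeasurableSpace V] {ρ : Measure V}
    [ρ.HasTemperateGrowth] : IsLocallyFiniteMeasure ρ where
  finiteAtNhds a := by
    let f (x : V) : ℝ := (1 + ‖x‖) ^ (-(ρ.integrablePower : ℝ))
    have hcont : ContinuousAt f a :=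
      ContinuousAt.rpow_const (by fun_prop) (.inl (by positivity))
    have hpos : 0 < f a := by positivity
    exact ⟨{x | f a / 2 ≤ f x}, hcont.eventually_const_le (half_lt_self hpos),
      ρ.integrable_pow_neg_integrablePower.measure_ge_lt_top (half_pos hpos)⟩

section Peak

variable {V : Type*} [NormedAddCommGroup V] [InnerProductSpace ℝ V]

/-- Gaussians concentrating at the frequency `k` as `n → ∞`, of height `1`. -/
noncomputable def peak (k : V) (n : ℕ) : 𝓢(V, ℂ) :=
  SchwartzMap.compSubConstCLM ℂ k (gaussian ((n : ℝ) + 1) n.cast_add_one_pos)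

theorem norm_peak_apply (k : V) (n : ℕ) (ξ : V) :
    ‖peak k n ξ‖ = Real.exp (-((n : ℝ) + 1) * ‖ξ - k‖ ^ 2) :=
  norm_gaussian_apply _ _

theorem peak_self (k : V) (n : ℕ) : peak k n k = 1 := by
  simp [peak, gaussian_apply]

theorem antitone_norm_peak (k ξ : V) : Antitone fun n => ‖peak k n ξ‖ := by
  intro m n hmn
  simp only [norm_peak_apply]
  gcongr

theorem tendsto_peak_of_ne {k ξ : V} (h : ξ ≠ k) :
    Tendsto (fun n => peak k n ξ) atTop (𝓝 0) := by
  have hpos : 0 < ‖ξ - k‖ ^ 2 := by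
    have := norm_pos_iff.2 (sub_ne_zero.2 h)
    positivity
  rw [tendsto_zero_iff_norm_tendsto_zero]
  simp_rw [norm_peak_apply]
  refine Real.tendsto_exp_atBot.comp ((tendsto_neg_atTop_atBot.comp ?_).atBot_mul_const hpos)
  exact tendsto_atTop_add_const_right _ _ tendsto_natCast_atTop_atTop

variable [FiniteDimensional ℝ V] [MeasurableSpace V] [BorelSpace V]

theorem lintegral_enorm_fourier_peak (k : V) (n : ℕ) : ∫⁻ x, ‖𝓕 (peak k n) x‖ₑ = 1 := by
  rw [← ofReal_integral_norm_eq_lintegral_enorm ((𝓕 (peak k n)).integrable (μ := volume))]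
  simp_rw [peak, fourier_compSubConstCLM_apply, norm_mul, Circle.norm_coe, one_mul]
  rw [integral_norm_fourier_gaussian, ENNReal.ofReal_one]

theorem modulate_zero (f : 𝓢(V, ℂ)) : modulate 0 f = f := by
  ext ξ
  simp [modulate_apply]

theorem tendsto_toLp_modulate_peak {ρ : Measure V} [ρ.HasTemperateGrowth] {p : ℝ≥0∞}
    [Fact (1 ≤ p)] (hp : p ≠ ∞) (k t : V) :
    Tendsto (fun n => (modulate t (peak k n)).toLp p ρ) atTop
      (𝓝 ((Real.fourierChar (-inner ℝ k t) : ℂ) • indicatorConstLp p (measurableSet_singleton k)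
        isCompact_singleton.measure_lt_top.ne 1)) := by
  let e : ℂ := Real.fourierChar (-inner ℝ k t)
  have hmem : MemLp (({k} : Set V).indicator fun _ => (1 : ℂ)) p ρ :=
    memLp_indicator_const p (measurableSet_singleton k) 1
      (.inr isCompact_singleton.measure_lt_top.ne)
  refine (Lp.tendsto_Lp_iff_tendsto_eLpNorm'' _ (fun n => (modulate t (peak k n)).memLp p ρ) _
    (hmem.const_smul e)).2 ?_
  refine tendsto_eLpNorm_zero_of_dominated hp
    (fun n => (modulate t (peak k n)).continuous.aestronglyMeasurable.sub
      (hmem.const_smul e).aestronglyMeasurable)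
    ((peak k 0).memLp p ρ) (fun n => ae_of_all _ fun ξ => ?_) (ae_of_all _ fun ξ => ?_)
  all_goals rcases eq_or_ne ξ k with rfl | h
  · simp [modulate_apply, peak_self, e]
  · simpa [norm_modulate_apply, h] using antitone_norm_peak k ξ n.zero_le
  · simp [modulate_apply, peak_self, e]
  · simpa [modulate_apply, h] using (tendsto_peak_of_ne h).const_mul _

end Peak

variable {d : ℕ} {μ : Measure (PointMeasure d)} [IsFiniteMeasure μ] {r : ℝ}

/-- The linear statistics of the Fourier transforms of Schwartz functions, as a linear map into
`L²(μ)`. -/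
noncomputable def fourierStatistic (hr : 0 < r) (hμ : ∀ᵐ ν ∂μ, IsUniformlyDiscrete r ν) :
    𝓢(Space d, ℂ) →ₗ[ℂ] Lp ℂ 2 μ where
  toFun f := (memLp_linearStatistic hr hμ (𝓕 f) 2).toLp
  map_add' f g := by
    rw [← MemLp.toLp_add]
    refine MemLp.toLp_congr _ _ (hμ.mono fun ν hν => ?_)
    have := hν.isTranslationBounded.hasTemperateGrowth (half_pos hr)
    rw [FourierTransform.fourier_add]
    exact integral_add (SchwartzMap.integrable _) (SchwartzMap.integrable _)
  map_smul' a f := by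
    rw [RingHom.id_apply, ← MemLp.toLp_const_smul]
    refine MemLp.toLp_congr _ _ (ae_of_all _ fun ν => ?_)
    rw [FourierTransform.fourier_smul a f]
    exact integral_const_mul a fun x => 𝓕 f x

theorem coeFn_fourierStatistic (hr : 0 < r) (hμ : ∀ᵐ ν ∂μ, IsUniformlyDiscrete r ν)
    (f : 𝓢(Space d, ℂ)) : fourierStatistic hr hμ f =ᵐ[μ] linearStatistic (𝓕 f) :=
  (memLp_linearStatistic hr hμ (𝓕 f) 2).coeFn_toLp

theorem IsStationaryLaw.compMeasurePreserving_fourierStatistic (hst : IsStationaryLaw μ)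
    (hr : 0 < r) (hμ : ∀ᵐ ν ∂μ, IsUniformlyDiscrete r ν) (t : Space d) (f : 𝓢(Space d, ℂ)) :
    Lp.compMeasurePreserving (PointMeasure.translate t) (hst t) (fourierStatistic hr hμ f) =
      fourierStatistic hr hμ (modulate t f) := by
  have hmem := memLp_linearStatistic hr hμ (𝓕 f) 2
  refine (Lp.toLp_compMeasurePreserving hmem (hst t)).trans
    (MemLp.toLp_congr (hmem.comp_measurePreserving (hst t))
      (memLp_linearStatistic hr hμ (𝓕 (modulate t f)) 2) (ae_of_all _ fun ν => ?_))
  rw [fourier_modulate]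
  exact linearStatistic_translate (𝓕 f) t ν

variable {σ : Measure (Space d)}

theorem IsStationaryLaw.exists_linearIsometry_toLp (hst : IsStationaryLaw μ) (hr : 0 < r)
    (hμ : ∀ᵐ ν ∂μ, IsUniformlyDiscrete r ν) [σ.HasTemperateGrowth]
    (hσ : IsFourierTransform (autocorrelation μ) σ) :
    ∃ W : Lp ℂ 2 σ →ₗᵢ[ℂ] Lp ℂ 2 μ, ∀ f : 𝓢(Space d, ℂ),
      W (f.toLp 2 σ) = fourierStatistic hr hμ f := by
  refine exists_linearIsometry_apply_eq (e := (SchwartzMap.toLpCLM ℂ ℂ 2 σ).toLinearMap)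
    (SchwartzMap.denseRange_toLpCLM ENNReal.ofNat_ne_top) fun f => ?_
  refine (Lp.norm_toLp _ (memLp_linearStatistic hr hμ (𝓕 f) 2)).trans
    (Eq.trans ?_ SchwartzMap.norm_toLp.symm)
  rw [hst.eLpNorm_linearStatistic_fourier hr hμ hσ]

theorem IsStationaryLaw.exists_eigenvector (hst : IsStationaryLaw μ) (hr : 0 < r)
    (hμ : ∀ᵐ ν ∂μ, IsUniformlyDiscrete r ν) (hσ : IsFourierTransform (autocorrelation μ) σ)
    (k : Space d) :
    ∃ c : Lp ℂ 2 μ, ‖c‖ = √(σ.real {k}) ∧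
      Tendsto (fun n => fourierStatistic hr hμ (peak k n)) atTop (𝓝 c) ∧
      ∀ t, Lp.compMeasurePreserving (PointMeasure.translate t) (hst t) c =
        (Real.fourierChar (-inner ℝ k t) : ℂ) • c := by
  have := hσ.temperate_right
  obtain ⟨W, hW⟩ := hst.exists_linearIsometry_toLp hr hμ hσ
  let u : Lp ℂ 2 σ := indicatorConstLp 2 (measurableSet_singleton k)
    isCompact_singleton.measure_lt_top.ne 1
  have hlim (t : Space d) : Tendsto (fun n => fourierStatistic hr hμ (modulate t (peak k n)))
      atTop (𝓝 ((Real.fourierChar (-inner ℝ k t) : ℂ) • W u)) := by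
    rw [← map_smul]
    simp_rw [← hW]
    exact (W.continuous.tendsto _).comp (tendsto_toLp_modulate_peak ENNReal.ofNat_ne_top k t)
  have hlim_peak : Tendsto (fun n => fourierStatistic hr hμ (peak k n)) atTop (𝓝 (W u)) := by
    simpa [modulate_zero] using hlim 0
  refine ⟨W u, ?_, hlim_peak, fun t => tendsto_nhds_unique ?_ (hlim t)⟩
  · rw [W.norm_map, norm_indicatorConstLp two_ne_zero ENNReal.ofNat_ne_top, norm_one, one_mul,
      Real.sqrt_eq_rpow, ENNReal.toReal_ofNat]
  · simp_rw [← hst.compMeasurePreserving_fourierStatistic hr hμ t]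
    exact ((Lp.isometry_compMeasurePreserving (hst t)).continuous.tendsto _).comp hlim_peak

end SpectralIsometry

section Ergodicity

open PointMeasure

variable {d : ℕ} {μ : Measure (PointMeasure d)}

theorem measurableSet_ae_translate_mem {A : Set (PointMeasure d)} (hA : MeasurableSet A) :
    MeasurableSet {ν | ∀ᵐ s : Space d, PointMeasure.translate s ν ∈ A} :=
  measurable_measure_prodMk_left ((measurable_translate.comp measurable_swap) hA).compl
    (measurableSet_singleton 0)

theorem preimage_translate_ae_translate_mem (A : Set (PointMeasure d)) (t : Space d) :
    PointMeasure.translate t ⁻¹' {ν | ∀ᵐ s : Space d, PointMeasure.translate s ν ∈ A} =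
      {ν | ∀ᵐ s : Space d, PointMeasure.translate s ν ∈ A} := by
  ext ν
  simp only [mem_preimage, mem_ofPred_eq, PointMeasure.translate_translate]
  exact eventually_add_right_iff (volume : Measure (Space d)) t
    (p := fun s => PointMeasure.translate s ν ∈ A)

theorem IsErgodicLaw.ae_mem_or_ae_notMem [SFinite μ] (he : IsErgodicLaw μ)
    {A : Set (PointMeasure d)} (hA : MeasurableSet A)
    (hinv : ∀ t : Space d, ∀ᵐ ν ∂μ, PointMeasure.translate t ν ∈ A ↔ ν ∈ A) :
    (∀ᵐ ν ∂μ, ν ∈ A) ∨ ∀ᵐ ν ∂μ, ν ∉ A := by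
  let D : Set (PointMeasure d) := {ν | ∀ᵐ s : Space d, PointMeasure.translate s ν ∈ A}
  have horbit : ∀ᵐ ν ∂μ, ∀ᵐ s : Space d, PointMeasure.translate s ν ∈ A ↔ ν ∈ A := by
    refine (Measure.ae_ae_comm (p := fun ν s => PointMeasure.translate s ν ∈ A ↔ ν ∈ A) ?_).2
      (ae_of_all _ hinv)
    exact ((measurable_translate.comp measurable_swap) hA).iff (measurable_fst hA)
  have hDA : ∀ᵐ ν ∂μ, ν ∈ D ↔ ν ∈ A := by
    filter_upwards [horbit] with ν hν
    exact (Filter.eventually_congr hν).trans Filter.eventually_const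
  rcases he D (measurableSet_ae_translate_mem hA) (preimage_translate_ae_translate_mem A)
    with h | h
  · right
    filter_upwards [hDA, measure_eq_zero_iff_ae_notMem.1 h] with ν hν hνD
    rwa [← hν]
  · left
    filter_upwards [hDA, measure_eq_zero_iff_ae_notMem.1 h] with ν hν hνD
    rwa [← hν, ← not_notMem]

theorem IsErgodicLaw.exists_ae_eq_const [SFinite μ] (he : IsErgodicLaw μ) {α : Type*}
    [MeasurableSpace α] [MeasurableSpace.CountablySeparated α] [Nonempty α]
    {g : PointMeasure d → α} (hg : Measurable g)
    (hinv : ∀ t : Space d, ∀ᵐ ν ∂μ, g (PointMeasure.translate t ν) = g ν) :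
    ∃ a, ∀ᵐ ν ∂μ, g ν = a := by
  refine Filter.exists_eventuallyEq_const_of_forall_separating MeasurableSet fun U hU => ?_
  exact he.ae_mem_or_ae_notMem (hg hU) fun t => (hinv t).mono fun ν hν =>
    iff_of_eq (congrArg (· ∈ U) hν)

theorem IsErgodicLaw.eLpNorm_eq_enorm [IsProbabilityMeasure μ] (he : IsErgodicLaw μ)
    {E : Type*} [NormedAddCommGroup E] {p q : ℝ≥0∞} (hp : p ≠ 0) (hq : q ≠ 0) {c : Lp E p μ}
    (hinv : ∀ t : Space d, ∀ᵐ ν ∂μ, ‖c (PointMeasure.translate t ν)‖ = ‖c ν‖) :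
    eLpNorm c q μ = ‖c‖ₑ := by
  obtain ⟨M, hM⟩ := he.exists_ae_eq_const (Lp.stronglyMeasurable c).norm.measurable hinv
  have hconst (s : ℝ≥0∞) (hs : s ≠ 0) : eLpNorm c s μ = ‖M‖ₑ := by
    rw [← eLpNorm_norm, eLpNorm_congr_ae hM, eLpNorm_const M hs (IsProbabilityMeasure.ne_zero μ)]
    simp
  rw [Lp.enorm_def, hconst p hp, hconst q hq]

end Ergodicity

section Difference

open PointMeasure

theorem enorm_integral_sub_integral_add_le {α E : Type*} {m : MeasurableSpace α}
    [NormedAddCommGroup E] [NormedSpace ℝ E] {ρ ρ' : Measure α} {s s' : Set α}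
    (hs : MeasurableSet s) (hs' : MeasurableSet s') (h : ρ.restrict s' = ρ'.restrict s)
    {f : α → E} (hf : Integrable f ρ) (hf' : Integrable f ρ') :
    ‖∫ x, f x ∂ρ - ∫ x, f x ∂ρ'‖ₑ + 2 * ∫⁻ x in s, ‖f x‖ₑ ∂ρ' ≤
      ∫⁻ x, ‖f x‖ₑ ∂ρ + ∫⁻ x, ‖f x‖ₑ ∂ρ' := by
  have hsplit : ∫ x, f x ∂ρ - ∫ x, f x ∂ρ' = ∫ x in s'ᶜ, f x ∂ρ - ∫ x in sᶜ, f x ∂ρ' := by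
    rw [← integral_add_compl hs' hf, ← integral_add_compl hs hf', h, add_sub_add_left_eq_sub]
  have hle : ‖∫ x, f x ∂ρ - ∫ x, f x ∂ρ'‖ₑ ≤
      ∫⁻ x in s'ᶜ, ‖f x‖ₑ ∂ρ + ∫⁻ x in sᶜ, ‖f x‖ₑ ∂ρ' := by
    rw [hsplit]
    exact enorm_sub_le.trans (add_le_add (enorm_integral_le_lintegral_enorm _)
      (enorm_integral_le_lintegral_enorm _))
  rw [← lintegral_add_compl _ hs' (μ := ρ), ← lintegral_add_compl _ hs (μ := ρ'), h]
  refine (add_le_add_left hle _).trans_eq ?_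
  ring

variable {d : ℕ}

namespace PointMeasure

theorem measure_eq_zero_of_lt_one (ν : PointMeasure d) {A : Set (Space d)} (hA : MeasurableSet A)
    (hb : Bornology.IsBounded A) (h : ν.toMeasure A < 1) : ν.toMeasure A = 0 := by
  obtain ⟨n, hn⟩ := ν.exists_nat' A hA hb
  rw [hn] at h ⊢
  exact_mod_cast Nat.lt_one_iff.1 (by exact_mod_cast h)

theorem countable_points (ν : PointMeasure d) : ν.points.Countable := by
  simpa only [points, pos_iff_ne_zero] using
    Measure.countable_meas_pos_of_disjoint_iUnion (μ := ν.toMeasure)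
      (measurableSet_singleton ·) fun _ _ => disjoint_singleton.2

theorem measure_compl_points (ν : PointMeasure d) : ν.toMeasure ν.pointsᶜ = 0 := by
  refine measure_null_of_locally_null _ fun x hx => ?_
  have hx0 : ν.toMeasure {x} < 1 := by simp_all [points]
  obtain ⟨U, hxU, hU, hU1⟩ := Set.exists_isOpen_lt_of_lt _ _ hx0
  have hopen : IsOpen (U ∩ Metric.ball x 1) := hU.inter Metric.isOpen_ball
  refine ⟨U ∩ Metric.ball x 1, mem_nhdsWithin_of_mem_nhds (hopen.mem_nhds
    ⟨singleton_subset_iff.1 hxU, Metric.mem_ball_self one_pos⟩), ?_⟩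
  exact ν.measure_eq_zero_of_lt_one hopen.measurableSet
    (Metric.isBounded_ball.subset inter_subset_right)
    ((measure_mono inter_subset_left).trans_lt hU1)

theorem restrict_points_self (ν : PointMeasure d) : ν.toMeasure.restrict ν.points = ν.toMeasure :=
  Measure.restrict_eq_self_of_ae_mem <|
    (measure_eq_zero_iff_ae_notMem.1 ν.measure_compl_points).mono fun _ => not_notMem.1

end PointMeasure

variable {r : ℝ}

theorem IsUniformlyDiscrete.measure_singleton {ν : PointMeasure d}
    (hν : IsUniformlyDiscrete r ν) (hr : 0 < r) {x : Space d} (hx : x ∈ ν.points) :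
    ν.toMeasure {x} = 1 := by
  refine le_antisymm ((measure_mono ?_).trans (hν.isTranslationBounded x)) (not_lt.1 fun h => ?_)
  · exact singleton_subset_iff.2 (Metric.mem_ball_self (half_pos hr))
  · exact hx (ν.measure_eq_zero_of_lt_one (measurableSet_singleton x)
      Bornology.isBounded_singleton h)

theorem IsUniformlyDiscrete.toMeasure_eq_count_restrict {ν : PointMeasure d}
    (hν : IsUniformlyDiscrete r ν) (hr : 0 < r) :
    ν.toMeasure = Measure.count.restrict ν.points := by
  refine Measure.ext_of_lintegral _ fun f _ => ?_
  rw [← ν.restrict_points_self, lintegral_countable f ν.countable_points,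
    lintegral_countable f ν.countable_points]
  simp [hν.measure_singleton hr]

theorem IsUniformlyDiscrete.restrict_points_comm {ν ν' : PointMeasure d}
    (hν : IsUniformlyDiscrete r ν) (hν' : IsUniformlyDiscrete r ν') (hr : 0 < r) :
    ν.toMeasure.restrict ν'.points = ν'.toMeasure.restrict ν.points := by
  rw [hν.toMeasure_eq_count_restrict hr, hν'.toMeasure_eq_count_restrict hr,
    Measure.restrict_restrict ν'.countable_points.measurableSet,
    Measure.restrict_restrict ν.countable_points.measurableSet, inter_comm]

theorem IsUniformlyDiscrete.setLIntegral_points {ν : PointMeasure d}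
    (hν : IsUniformlyDiscrete r ν) (hr : 0 < r) (ρ : Measure (Space d)) (f : Space d → ℝ≥0∞) :
    ∫⁻ x in ν.points, f x ∂ρ = ∫⁻ x, f x * ν.toMeasure {x} ∂ρ := by
  rw [← lintegral_indicator ν.countable_points.measurableSet]
  refine lintegral_congr fun x => ?_
  by_cases hx : x ∈ ν.points
  · simp [hx, hν.measure_singleton hr hx]
  · simp_all [points]

variable {μ : Measure (PointMeasure d)}

theorem IsStationaryLaw.lintegral_mul_measure_singleton_add [SFinite μ] (hst : IsStationaryLaw μ)
    {h : Space d → ℝ≥0∞} (hh : Measurable h) (s : Space d) :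
    ∫⁻ ν, ∫⁻ x, h x * ν.toMeasure {x + s} ∂ν.toMeasure ∂μ =
      autocorrelation μ {s} * ∫⁻ x, h x := by
  have hs : Measurable (({s} : Set (Space d)).indicator (1 : Space d → ℝ≥0∞)) :=
    measurable_one.indicator (measurableSet_singleton s)
  let H (p : Space d × Space d) : ℝ≥0∞ := h p.1 * ({s} : Set (Space d)).indicator 1 (p.2 - p.1)
  have hH : Measurable H := by fun_prop
  have hinner (ν : PointMeasure d) (x : Space d) :
      ∫⁻ y, H (x, y) ∂ν.toMeasure = h x * ν.toMeasure {x + s} := by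
    classical
    rw [← lintegral_indicator_one (measurableSet_singleton _), ← lintegral_const_mul _
      (measurable_one.indicator (measurableSet_singleton _))]
    simp only [H, indicator_apply, mem_singleton_iff, sub_eq_iff_eq_add', Pi.one_apply]
  calc ∫⁻ ν, ∫⁻ x, h x * ν.toMeasure {x + s} ∂ν.toMeasure ∂μ
      = ∫⁻ p, H p ∂(secondMoment μ) := by
        simp_rw [PointMeasure.lintegral_secondMoment μ hH, hinner]
    _ = ∫⁻ z, ∫⁻ x, H (x, x + z) ∂volume ∂(autocorrelation μ) := hst.lintegral_secondMoment hH
    _ = autocorrelation μ {s} * ∫⁻ x, h x := by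
        simp only [H, add_sub_cancel_left]
        simp_rw [lintegral_mul_const _ hh]
        rw [lintegral_const_mul _ hs, lintegral_indicator_one (measurableSet_singleton s), mul_comm]

theorem IsStationaryLaw.lintegral_lintegral [SFinite μ] (hst : IsStationaryLaw μ) (hr : 0 < r)
    (hμ : ∀ᵐ ν ∂μ, IsUniformlyDiscrete r ν) {h : Space d → ℝ≥0∞} (hh : Measurable h) :
    ∫⁻ ν, ∫⁻ x, h x ∂ν.toMeasure ∂μ = autocorrelation μ {0} * ∫⁻ x, h x := by
  rw [← hst.lintegral_mul_measure_singleton_add hh]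
  refine lintegral_congr_ae (hμ.mono fun ν hν => ?_)
  simp_rw [add_zero]
  rw [← hν.setLIntegral_points hr, ν.restrict_points_self]

theorem IsStationaryLaw.lintegral_setLIntegral_points_translate [SFinite μ]
    (hst : IsStationaryLaw μ) (hr : 0 < r) (hμ : ∀ᵐ ν ∂μ, IsUniformlyDiscrete r ν)
    {h : Space d → ℝ≥0∞} (hh : Measurable h) (t : Space d) :
    ∫⁻ ν, ∫⁻ x in ν.points, h x ∂(PointMeasure.translate t ν).toMeasure ∂μ =
      autocorrelation μ {t} * ∫⁻ x, h x := by
  rw [← lintegral_add_left_eq_self h t, ← hst.lintegral_mul_measure_singleton_add (by fun_prop)]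
  refine lintegral_congr_ae (hμ.mono fun ν hν => ?_)
  simp_rw [hν.setLIntegral_points hr, lintegral_translate, add_comm t]

theorem IsStationaryLaw.lintegral_enorm_linearStatistic_translate_sub_add_le [SFinite μ]
    (hst : IsStationaryLaw μ) (hr : 0 < r) (hμ : ∀ᵐ ν ∂μ, IsUniformlyDiscrete r ν)
    (φ : 𝓢(Space d, ℂ)) (t : Space d) :
    ∫⁻ ν, ‖linearStatistic φ ν - linearStatistic φ (PointMeasure.translate t ν)‖ₑ ∂μ +
        2 * (autocorrelation μ {t} * ∫⁻ x, ‖φ x‖ₑ) ≤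
      2 * (autocorrelation μ {0} * ∫⁻ x, ‖φ x‖ₑ) := by
  have hφ : Measurable fun x => ‖φ x‖ₑ := φ.continuous.measurable.enorm
  have hpoint : ∀ᵐ ν ∂μ,
      ‖linearStatistic φ ν - linearStatistic φ (PointMeasure.translate t ν)‖ₑ +
        2 * ∫⁻ x in ν.points, ‖φ x‖ₑ ∂(PointMeasure.translate t ν).toMeasure ≤
      ∫⁻ x, ‖φ x‖ₑ ∂ν.toMeasure + ∫⁻ x, ‖φ x‖ₑ ∂(PointMeasure.translate t ν).toMeasure := by
    filter_upwards [hμ, (hst t).quasiMeasurePreserving.ae hμ] with ν hν hνt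
    have := hν.isTranslationBounded.hasTemperateGrowth (half_pos hr)
    have := hνt.isTranslationBounded.hasTemperateGrowth (half_pos hr)
    exact enorm_integral_sub_integral_add_le ν.countable_points.measurableSet
      (PointMeasure.translate t ν).countable_points.measurableSet
      (hν.restrict_points_comm hνt hr) (SchwartzMap.integrable φ) (SchwartzMap.integrable φ)
  have hm : Measurable fun ν : PointMeasure d => ∫⁻ x, ‖φ x‖ₑ ∂ν.toMeasure :=
    measurable_lintegral (hφ.comp measurable_snd)
  have hmean := hst.lintegral_lintegral hr hμ hφ
  have hd : Measurable fun ν =>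
      ‖linearStatistic φ ν - linearStatistic φ (PointMeasure.translate t ν)‖ₑ :=
    ((stronglyMeasurable_linearStatistic φ).measurable.sub
      ((stronglyMeasurable_linearStatistic φ).measurable.comp (hst t).measurable)).enorm
  have hint := lintegral_mono_ae hpoint
  rw [lintegral_add_left hd, lintegral_add_left hm,
    lintegral_const_mul' _ _ ENNReal.ofNat_ne_top,
    hst.lintegral_setLIntegral_points_translate hr hμ hφ, (hst t).lintegral_comp hm,
    hmean, ← two_mul] at hint
  exact hint

end Difference

section Inequality

open PointMeasure Filter Topology

theorem norm_one_sub_fourierChar_neg (x : ℝ) :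
    ‖1 - (Real.fourierChar (-x) : ℂ)‖ = ‖Complex.exp (2 * Real.pi * Complex.I * x) - 1‖ := by
  have hexp : Complex.exp (2 * Real.pi * Complex.I * x) = Real.fourierChar x := by
    rw [Real.fourierChar_apply]
    push_cast
    ring_nf
  rw [hexp, AddChar.map_neg_eq_inv, Circle.coe_inv_eq_conj, norm_sub_rev,
    ← Complex.norm_conj, map_sub, Complex.conj_conj, map_one]

variable {d : ℕ} {μ : Measure (PointMeasure d)} {r : ℝ}

theorem IsStationaryLaw.eLpNorm_fourierStatistic_peak_sub_le [IsFiniteMeasure μ]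
    (hst : IsStationaryLaw μ) (hr : 0 < r) (hμ : ∀ᵐ ν ∂μ, IsUniformlyDiscrete r ν)
    (k t : Space d) (n : ℕ) :
    eLpNorm (fourierStatistic hr hμ (peak k n) - Lp.compMeasurePreserving
        (PointMeasure.translate t) (hst t) (fourierStatistic hr hμ (peak k n)) : Lp ℂ 2 μ) 1 μ ≤
      2 * autocorrelation μ {0} - 2 * autocorrelation μ {t} := by
  have := hasTemperateGrowth_autocorrelation hr hμ
  let φ : 𝓢(Space d, ℂ) := 𝓕 (peak k n)
  have hF := coeFn_fourierStatistic hr hμ (peak k n)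
  have hcongr : ⇑(fourierStatistic hr hμ (peak k n) - Lp.compMeasurePreserving
      (PointMeasure.translate t) (hst t) (fourierStatistic hr hμ (peak k n)) : Lp ℂ 2 μ) =ᵐ[μ]
      fun ν => linearStatistic φ ν - linearStatistic φ (PointMeasure.translate t ν) :=
    (Lp.coeFn_sub _ _).trans <| hF.sub <| (Lp.coeFn_compMeasurePreserving _ (hst t)).trans <|
      (hst t).quasiMeasurePreserving.ae_eq_comp hF
  rw [eLpNorm_congr_ae hcongr, eLpNorm_one_eq_lintegral_enorm]
  refine ENNReal.le_sub_of_add_le_right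
    (ENNReal.mul_ne_top ENNReal.ofNat_ne_top isCompact_singleton.measure_lt_top.ne) ?_
  simpa only [φ, lintegral_enorm_fourier_peak, mul_one] using
    hst.lintegral_enorm_linearStatistic_translate_sub_add_le hr hμ φ t

theorem IsStationaryLaw.autocorrelation_singleton_le [IsFiniteMeasure μ]
    (hst : IsStationaryLaw μ) (hr : 0 < r) (hμ : ∀ᵐ ν ∂μ, IsUniformlyDiscrete r ν) (t : Space d) :
    autocorrelation μ {t} ≤ autocorrelation μ {0} := by
  have h := le_add_self.trans
    (hst.lintegral_enorm_linearStatistic_translate_sub_add_le hr hμ (𝓕 (peak (0 : Space d) 0)) t)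
  rw [lintegral_enorm_fourier_peak, mul_one, mul_one] at h
  exact (ENNReal.mul_le_mul_iff_right two_ne_zero ENNReal.ofNat_ne_top).1 h

theorem IsStationaryLaw.eLpNorm_sub_compMeasurePreserving_le [IsFiniteMeasure μ]
    (hst : IsStationaryLaw μ) (hr : 0 < r) (hμ : ∀ᵐ ν ∂μ, IsUniformlyDiscrete r ν)
    {k : Space d} {c : Lp ℂ 2 μ}
    (hc : Tendsto (fun n => fourierStatistic hr hμ (peak k n)) atTop (𝓝 c)) (t : Space d) :
    eLpNorm (c - Lp.compMeasurePreserving (PointMeasure.translate t) (hst t) c : Lp ℂ 2 μ) 1 μ ≤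
      2 * autocorrelation μ {0} - 2 * autocorrelation μ {t} := by
  have hlim := hc.sub
    (((Lp.isometry_compMeasurePreserving (hst t)).continuous.tendsto c).comp hc)
  exact eLpNorm_le_of_tendstoInMeasure
    (.of_forall fun n => hst.eLpNorm_fourierStatistic_peak_sub_le hr hμ k t n)
    (tendstoInMeasure_of_tendsto_Lp hlim) fun n => (Lp.stronglyMeasurable _).aestronglyMeasurable

theorem IsErgodicLaw.eLpNorm_eq_enorm_of_compMeasurePreserving_eq [IsProbabilityMeasure μ]
    (he : IsErgodicLaw μ) (hst : IsStationaryLaw μ) {p q : ℝ≥0∞} (hp : p ≠ 0) (hq : q ≠ 0)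
    {c : Lp ℂ p μ} {χ : Space d → Circle}
    (hc : ∀ t, Lp.compMeasurePreserving (PointMeasure.translate t) (hst t) c = (χ t : ℂ) • c) :
    eLpNorm c q μ = ‖c‖ₑ := by
  refine he.eLpNorm_eq_enorm hp hq fun t => ?_
  filter_upwards [Lp.coeFn_compMeasurePreserving c (hst t), Lp.coeFn_smul (χ t : ℂ) c] with ν h h'
  rw [← Function.comp_apply (f := c), ← h, hc t, h', Pi.smul_apply, norm_smul, Circle.norm_coe,
    one_mul]

theorem IsErgodicLaw.norm_exp_sub_one_mul_sqrt_le [IsProbabilityMeasure μ]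
    (he : IsErgodicLaw μ) (hst : IsStationaryLaw μ) (hr : 0 < r)
    (hμ : ∀ᵐ ν ∂μ, IsUniformlyDiscrete r ν) {σ : Measure (Space d)}
    (hσ : IsFourierTransform (autocorrelation μ) σ) (k t : Space d) :
    ‖Complex.exp (2 * Real.pi * Complex.I * (inner ℝ k t : ℝ)) - 1‖ * √(σ.real {k}) ≤
      2 * ((autocorrelation μ).real {0} - (autocorrelation μ).real {t}) := by
  have := hasTemperateGrowth_autocorrelation hr hμ
  have hfin (s : Space d) : 2 * autocorrelation μ {s} ≠ ∞ :=
    ENNReal.mul_ne_top ENNReal.ofNat_ne_top isCompact_singleton.measure_lt_top.ne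
  obtain ⟨c, hnorm, hlim, heigen⟩ := hst.exists_eigenvector hr hμ hσ k
  have hdiff : eLpNorm (c - Lp.compMeasurePreserving (PointMeasure.translate t) (hst t) c :
      Lp ℂ 2 μ) 1 μ = ‖1 - (Real.fourierChar (-inner ℝ k t) : ℂ)‖ₑ * ‖c‖ₑ := by
    have hsmul : c - (Real.fourierChar (-inner ℝ k t) : ℂ) • c =
        (1 - (Real.fourierChar (-inner ℝ k t) : ℂ)) • c := by rw [sub_smul, one_smul]
    rw [heigen, hsmul, eLpNorm_congr_ae (Lp.coeFn_smul _ c), eLpNorm_const_smul,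
      he.eLpNorm_eq_enorm_of_compMeasurePreserving_eq hst two_ne_zero one_ne_zero heigen]
  have hle : 2 * autocorrelation μ {t} ≤ 2 * autocorrelation μ {0} :=
    mul_le_mul_right (hst.autocorrelation_singleton_le hr hμ t) 2
  have hbound := ENNReal.toReal_mono (ENNReal.sub_ne_top (hfin 0))
    (hdiff ▸ hst.eLpNorm_sub_compMeasurePreserving_le hr hμ hlim t)
  rwa [ENNReal.toReal_mul, toReal_enorm, toReal_enorm, norm_one_sub_fourierChar_neg, hnorm,
    ENNReal.toReal_sub_of_le hle (hfin 0), ENNReal.toReal_mul, ENNReal.toReal_mul,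
    ENNReal.toReal_ofNat, ← mul_sub] at hbound

end Inequality

theorem proposition10p1_general {d : ℕ} {μ : Measure (PointMeasure d)} [IsProbabilityMeasure μ]
    (hud : ∃ r : ℝ, 0 < r ∧ ∀ᵐ ν ∂μ, IsUniformlyDiscrete r ν) (hst : IsStationaryLaw μ)
    (he : IsErgodicLaw μ) :
    (∃! σ : Measure (Space d), IsFourierTransform (firstMoment (palmMeasure μ)) σ) ∧
    ∀ σ : Measure (Space d), IsFourierTransform (firstMoment (palmMeasure μ)) σ →
      ∀ k t : Space d,
        ‖Complex.exp (2 * Real.pi * Complex.I * (inner ℝ k t : ℝ)) - 1‖ * √(σ.real {k}) ≤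
          2 * ((firstMoment (palmMeasure μ)).real {0} -
            (firstMoment (palmMeasure μ)).real {t}) := by
  obtain ⟨r, hr, hμ⟩ := hud
  exact ⟨hst.existsUnique_isFourierTransform_autocorrelation hr hμ,
    fun σ hσ k t => he.norm_exp_sub_one_mul_sqrt_le hst hr hμ hσ k t⟩

theorem proposition10p1 (d : ℕ) (μ : Measure (PointMeasure d))
    (hμ : IsUniformlyDiscreteErgodicProcess μ)
    (hflc : ∀ᵐ ν ∂μ, HasFiniteLocalComplexity ν.points) :
    (∃! σ : Measure (Space d), IsFourierTransform (firstMoment (palmMeasure μ)) σ) ∧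
    ∀ σ : Measure (Space d), IsFourierTransform (firstMoment (palmMeasure μ)) σ →
      ∀ k t : Space d,
        ‖Complex.exp (2 * Real.pi * Complex.I * (inner ℝ k t : ℝ)) - 1‖ * √(σ.real {k}) ≤
          2 * ((firstMoment (palmMeasure μ)).real {0} - (firstMoment (palmMeasure μ)).real {t}) := by
  have := hμ.isProbabilityMeasure
  exact proposition10p1_general hμ.uniformlyDiscrete hμ.stationary hμ.ergodic
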